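/- **Model.** Fix reals $\alpha>2$, $\beta\ge 1$, $\mathcal N\ge 1$, $\varepsilon>0$ and a transmission power $p>0$. A network consists of finitely many stations placed at distinct points of the Euclidean plane, with distinct IDs from $\{1,\dots,N\}$. If $\mathcal T$ is the set of stations that transmit in a round, then a station $u$ hears a station $v$ in that round iff $v\in\mathcal T$, $u\notin\mathcal T$, $$\frac{p\,\mathrm{dist}(v,u)^{-\alpha}}{\mathcal N+\sum_{w\in\mathcal T\setminus\{v\}}p\,\mathrm{dist}(w,u)^{-\alpha}}\ \ge\ \beta\qquad\text{and}\qquad p\,\mathrm{dist}(v,u)^{-\alpha}\ge(1+\varepsilon)\beta\mathcal N .$$ The communication graph $G$ joins two distinct stations at distance at most $r=\bigl(p/((1+\varepsilon)\beta\mathcal N)\bigr)^{1/\alpha}$. Stations work in synchronous rounds, each transmitting one message or listening; there is no collision detection. Initially a station knows only its own ID, its own coordinates, the global parameters $N$ and $\Delta$, and the fixed model constants. Protocols are deterministic and distributed: what a station does depends only on what it knows initially and on what it has heard. A message carries $O(\log N)$ control bits and, in the protocols (A1) and (A2) below, also at most one message of the task being solved (an element of an arbitrary set $R$). **Theorem.**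 There are constants (all constants in the $O$-notation and the exponent of the polylogarithm) depending only on $\alpha,\beta,\mathcal N,\varepsilon,p$ such that for all $N$ and $\Delta$ there is a deterministic distributed algorithm which on every network with IDs in $\{1,\dots,N\}$ whose communication graph $G$ is connected with all degrees at most $\Delta$, runs for $O(\Delta\,\mathrm{polylog}\,N)$ rounds, after which each station knows whether it belongs to a set $H$ of stations, the *backbone*, and knows the ID of a station, its *leader*, such that: * (P1) $H$ is a connected dominating set of $G$; * (P2) $|H|=O(m)$, where $m$ is the size of a smallest connected dominating set of $G$; * (P3) each station has exactly one leader; the leader belongs to $H$ and is a neighbour of the station, except that a station that is a leader is its own leader. Moreover, after the algorithm each station knows how to behave in the following two protocols, which for every set $R$ of possible messages work on every such network: * (A1) a *multi-round* protocol of $O(1)$ rounds that simulates one round of message passing on the subgraph $G[H]$ induced by $H$: if each $u\in H$ has for each of its neighbours $v$ in $G[H]$ an (optional) message $m_{u,v}\in R$, then at the end each $v\in H$ knows exactly the messages $m_{u,v}$ sent to it, with their senders $u$, and each station whose leader is $v$ also knows exactly these messages with their senders; * (A2) a *convergecast* protocol of $O(\Delta)$ rounds: if each station $v$ has a message $m_v\in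 R$, then at the end each station knows exactly the messages $m_v$ of the stations $v$ whose leader it is, with their originators; so the message of every station reaches its leader. -/

import Mathlib

/-- The Euclidean plane. -/
abbrev Plane : Type := EuclideanSpace ℝ (Fin 2)

/-- The fixed parameters of the uniform-power SINR model: path loss `α > 2`, threshold `β ≥ 1`,
ambient noise at least `1`, sensitivity `ε > 0`, and the common transmission power. -/
structure SINRParams where
  α : ℝ
  β : ℝ
  noise : ℝ
  ε : ℝ
  power : ℝ
  two_lt_α : 2 < α
  one_le_β : 1 ≤ β
  one_le_noise : 1 ≤ noise
  ε_pos : 0 < ε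
  power_pos : 0 < power

/-- The communication range: the radius at which the received power of a lone transmitter
equals `(1 + ε) * β * noise`. -/
noncomputable def SINRParams.range (P : SINRParams) : ℝ :=
  (P.power / ((1 + P.ε) * P.β * P.noise)) ^ (1 / P.α)

/-- A placement of the stations `V` at distinct points of the plane, with distinct identifiers
from a set of `N` identifiers. -/
structure Network (N : ℕ) (V : Type) where
  id : V → Fin N
  id_injective : Function.Injective id
  pos : V → Plane
  pos_injective : Function.Injective pos

namespace Network

variable {N : ℕ} {V : Type}

/-- The communication graph: distinct stations within range of each other. -/
noncomputable def graph (P : SINRParams) (net : Network N V) : SimpleGraph V where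
  Adj u v := u ≠ v ∧ dist (net.pos u) (net.pos v) ≤ P.range
  symm := ⟨fun _ _ h => ⟨h.1.symm, by rw [dist_comm]; exact h.2⟩⟩
  loopless := ⟨fun _ h => h.1 rfl⟩

/-- The power at which the signal of `w` arrives at `u`. -/
noncomputable def signal (P : SINRParams) (net : Network N V) (w u : V) : ℝ :=
  P.power / dist (net.pos w) (net.pos u) ^ P.α

open Classical in
/-- The signal-to-interference-and-noise ratio of `v` at `u` when exactly the stations in `T`
transmit. -/
noncomputable def sinr [Fintype V] (P : SINRParams) (net : Network N V) (v u : V) (T : Set V) : ℝ :=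
  net.signal P v u / (P.noise + ∑ w with w ∈ T ∧ w ≠ v, net.signal P w u)

/-- `u` successfully receives the message of `v` in a round in which exactly the stations in `T`
transmit. -/
def Hears [Fintype V] (P : SINRParams) (net : Network N V) (v u : V) (T : Set V) : Prop :=
  v ∈ T ∧ u ∉ T ∧ P.β ≤ net.sinr P v u T ∧ (1 + P.ε) * P.β * P.noise ≤ net.signal P v u

theorem signal_nonneg (P : SINRParams) (net : Network N V) (w u : V) : 0 ≤ net.signal P w u :=
  div_nonneg P.power_pos.le (Real.rpow_nonneg dist_nonneg _)

/-- At most one station is heard by `u` in a round, so `heard` below involves no choice. -/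
theorem Hears.unique [Fintype V] {P : SINRParams} {net : Network N V} {v v' u : V} {T : Set V}
    (h : net.Hears P v u T) (h' : net.Hears P v' u T) : v = v' := by
  classical
  by_contra hne
  have key : ∀ a b : V, a ≠ b → net.Hears P a u T → net.Hears P b u T →
      net.signal P b u < net.signal P a u := by
    intro a b hab ha hb
    have hle : net.signal P b u ≤ ∑ w with w ∈ T ∧ w ≠ a, net.signal P w u :=
      Finset.single_le_sum (f := fun w => net.signal P w u)
        (fun w _ => signal_nonneg P net w u) (by simp [hb.1, Ne.symm hab])
    have hs := signal_nonneg P net b u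
    have hn := P.one_le_noise
    have hden : 0 < P.noise + ∑ w with w ∈ T ∧ w ≠ a, net.signal P w u := by linarith
    have h1 : 1 ≤ net.sinr P a u T := P.one_le_β.trans ha.2.2.1
    unfold sinr at h1
    rw [le_div_iff₀ (by convert hden), one_mul] at h1
    have h2 : P.noise + ∑ w with w ∈ T ∧ w ≠ a, net.signal P w u ≤ net.signal P a u := by
      convert h1
    linarith
  exact lt_asymm (key v v' hne h h') (key v' v (Ne.symm hne) h' h)

open Classical in
/-- What `u` receives in a round in which each station `w` transmits `msg w` (`none`: `w` listens).
A station that receives nothing gets no further information from the channel. -/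
noncomputable def heard [Fintype V] (P : SINRParams) (net : Network N V) {M : Type}
    (msg : V → Option M) (u : V) : Option M :=
  if h : ∃ v, net.Hears P v u {w | (msg w).isSome} then msg h.choose else none

end Network

/-- A deterministic distributed protocol running for a fixed number of synchronous rounds. All
stations run the same code; a station starts from its private input in `I`, in each round either
transmits one message from `M` or listens, updates its state by what it received, and at the end
computes a private output in `O`. -/
structure Protocol (I M O : Type) where
  State : Type
  rounds : ℕ
  init : I → State
  send : State → Option M
  step : State → Option M → State
  output : State → O

namespace Protocol

variable {N : ℕ} {V : Type} [Fintype V] {I M O : Type}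

/-- The states of all stations after `t` rounds. -/
noncomputable def stateAt (π : Protocol I M O) (P : SINRParams) (net : Network N V)
    (input : V → I) : ℕ → V → π.State
  | 0 => fun v => π.init (input v)
  | t + 1 => fun v =>
      π.step (π.stateAt P net input t v)
        (net.heard P (fun w => π.send (π.stateAt P net input t w)) v)

/-- The outputs of all stations at the end of the execution. -/
noncomputable def run (π : Protocol I M O) (P : SINRParams) (net : Network N V)
    (input : V → I) (v : V) : O :=
  π.output (π.stateAt P net input π.rounds v)

end Protocol

/-- The `O(log N)` control bits of a message. -/
abbrev ControlBits (c N : ℕ) : Type := Fin (c * (Nat.log 2 N + 1)) → Bool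

/-- A message carrying at most one rumor from `R` and `O(log N)` control bits. -/
abbrev RumorMessage (R : Type) (c N : ℕ) : Type := Option R × ControlBits c N

/-- What a station knows when the construction of the backbone is finished: whether it belongs to
the backbone, the identifier of its leader, and further information for the later protocols. -/
structure BackboneRecord (N : ℕ) (Q : Type) where
  inBackbone : Bool
  leader : Fin N
  memory : Q

/-- An algorithm for constructing a backbone: initially a station knows only its identifier and its
position (and the global parameters), and messages consist of control bits only. -/
abbrev BackboneBuilder (c N : ℕ) (Q : Type) : Type 1 :=
  Protocol (Fin N × Plane) (ControlBits c N) (BackboneRecord N Q)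

/-- The records of all stations after the construction. -/
noncomputable def BackboneBuilder.records {c N : ℕ} {Q V : Type} [Fintype V]
    (build : BackboneBuilder c N Q) (P : SINRParams) (net : Network N V) :
    V → BackboneRecord N Q :=
  Protocol.run build P net (fun v => (net.id v, net.pos v))

/-- The stations whose records say that they belong to the backbone. -/
def backboneSet {N : ℕ} {Q V : Type} [Fintype V] (rec : V → BackboneRecord N Q) : Finset V :=
  Finset.univ.filter fun v => (rec v).inBackbone = true

/-- `ℓ` is the leader of `v`, that is, `v` is associated with `ℓ`. -/
def IsLeaderOf {N : ℕ} {Q V : Type} (net : Network N V) (rec : V → BackboneRecord N Q)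
    (ℓ v : V) : Prop :=
  (rec v).leader = net.id ℓ

/-- `D` is a connected dominating set of `G`. -/
def IsConnectedDominatingSet {V : Type} (G : SimpleGraph V) (D : Finset V) : Prop :=
  (G.induce (D : Set V)).Connected ∧ ∀ v, v ∉ D → ∃ u ∈ D, G.Adj v u

/-- The networks considered: the communication graph is connected with degrees at most `Δ`. -/
def Network.Admissible {N : ℕ} {V : Type} (P : SINRParams) (Δ : ℕ) (net : Network N V) : Prop :=
  (net.graph P).Connected ∧ ∀ v, ((net.graph P).neighborSet v).ncard ≤ Δ

/-- The stations marked as backbone form a connected dominating set, at most `c` times as large as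
any connected dominating set, and each station has exactly one leader, which is in the backbone
and is a neighbour of the station; leaders are their own leaders. -/
def IsBackbone {N : ℕ} {Q V : Type} [Fintype V] (P : SINRParams) (c : ℕ) (net : Network N V)
    (rec : V → BackboneRecord N Q) : Prop :=
  IsConnectedDominatingSet (net.graph P) (backboneSet rec) ∧
  (∀ D : Finset V, IsConnectedDominatingSet (net.graph P) D →
    (backboneSet rec).card ≤ c * D.card) ∧
  ∀ v, ∃! ℓ, IsLeaderOf net rec ℓ v ∧ ℓ ∈ backboneSet rec ∧
    (ℓ = v ∨ (net.graph P).Adj v ℓ) ∧ IsLeaderOf net rec ℓ ℓ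

/-- In one round of message passing on the backbone, where each backbone station `u` has for each
identifier `i` of a neighbour in the backbone possibly a message `m u i`, the message delivered to
the backbone station `v` from the station with identifier `i` is `r`. -/
def Delivered {N : ℕ} {Q V R : Type} [Fintype V] (P : SINRParams) (net : Network N V)
    (rec : V → BackboneRecord N Q) (m : V → Fin N → Option R) (v : V) (i : Fin N) (r : R) : Prop :=
  ∃ u ∈ backboneSet rec, (net.graph P).Adj u v ∧ net.id u = i ∧ m u (net.id v) = some r

/-- Input of a station in a multi-round: its record and its outgoing messages, by receiver.
Output: the messages received in the simulated round, by sender, and the messages received by its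
leader, by sender. -/
abbrev MultiRound (c N : ℕ) (Q R : Type) : Type 1 :=
  Protocol (BackboneRecord N Q × (Fin N → Option R)) (RumorMessage R c N)
    ((Fin N → Option R) × (Fin N → Option R))

/-- The multi-round simulates one round of message passing on the backbone: for any outgoing
messages, each backbone station ends up with exactly the messages sent to it by its neighbours in
the backbone, and each station with exactly those sent to its leader. -/
def SimulatesMessagePassing {c N : ℕ} {Q V R : Type} [Fintype V] (P : SINRParams)
    (net : Network N V) (rec : V → BackboneRecord N Q) (multi : MultiRound c N Q R) : Prop :=
  ∀ m : V → Fin N → Option R,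
    (∀ v ∈ backboneSet rec, ∀ i r,
      (multi.run P net (fun u => (rec u, m u)) v).1 i = some r ↔ Delivered P net rec m v i r) ∧
    ∀ w ℓ, IsLeaderOf net rec ℓ w → ∀ i r,
      (multi.run P net (fun u => (rec u, m u)) w).2 i = some r ↔ Delivered P net rec m ℓ i r

/-- Input of a station in a convergecast: its record and its message.
Output: the messages collected, by originating station. -/
abbrev Convergecast (c N : ℕ) (Q R : Type) : Type 1 :=
  Protocol (BackboneRecord N Q × R) (RumorMessage R c N) (Fin N → Option R)

/-- The convergecast delivers the message of each station to its leader: each station ends up with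
exactly the messages of the stations associated with it. -/
def CollectsAtLeaders {c N : ℕ} {Q V R : Type} [Fintype V] (P : SINRParams)
    (net : Network N V) (rec : V → BackboneRecord N Q) (conv : Convergecast c N Q R) : Prop :=
  ∀ (m : V → R) (ℓ : V) (i : Fin N) (r : R),
    conv.run P net (fun u => (rec u, m u)) ℓ i = some r ↔
      ∃ v, IsLeaderOf net rec ℓ v ∧ net.id v = i ∧ m v = r

/-! The plane is cut into square boxes of side `r / 2`, so the stations of a box form a clique of at
most `Δ + 1` stations. Boxes congruent modulo a constant, the dilution, form a class. Since `α > 2`,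
the lattice sum of `‖z‖ ^ (-α)` converges, and the dilution can be so large that when only one class
transmits, with at most one transmitter per box, every neighbour of a transmitter hears it
(`Network.heard_eq_some_iff`). There are constantly many classes, so what remains is to keep
stations of one box from transmitting together.

Breaking this symmetry is the main difficulty. A counting argument (`exists_hash_family`) yields
`Nat.log 2 N + 1` hash functions into `2 ^ 64 * k` values with few collisions on average on every
set of at most `k` identifiers. If at most `k` stations per box transmit in the rounds given by
their hash values, averaging controls both the collisions in a box and the interference from other
boxes: all but `k / 4` of them are heard, for some hash function, by the rest of their box
(`Network.four_mul_card_unheard_le`). Stages with halving `k` cost a geometric series, in total `O(Δ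
log N)` rounds. In a first run, stations withdraw on hearing a smaller identifier from their box,
which leaves one leader per box. In a second run the leader echoes what it hears, which gives all
stations of the box the same complete roster, hence private slots.

With slots, every station learns its neighbours. Seen from a given box, a class singles out at most
one neighbouring box; the station of smallest identifier with a neighbour there becomes the gateway
and names a contact. Leaders, gateways and contacts form `H`. An edge between boxes is replaced by a
path leader, gateway, contact, leader, which gives connectivity. Each box has boundedly many roles,
and a dominator accounts for at most 25 boxes, which bounds the size. A role has one holder per box,
so one round for each pair of class and role of sender and receiver simulates message passing, and
one round for each class and slot gives the convergecast. -/

/-! ### Hash families by counting -/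

open Finset in
/-- The number of functions on `X` which repeat on each `x ∈ D` a value taken at one of at most `k`
places of smaller rank. -/
theorem card_repeating_mul_pow_le {X : Type*} [Fintype X] [DecidableEq X] (rk : X → ℕ)
    (E : X → Finset X) (hE : ∀ x, ∀ y ∈ E x, rk y < rk x) (k q : ℕ) (hk : ∀ x, #(E x) ≤ k)
    (D : Finset X) (F : Finset (X → Fin q)) (hF : ∀ h ∈ F, ∀ x ∈ D, ∃ y ∈ E x, h y = h x) :
    #F * q ^ #D ≤ k ^ #D * q ^ Fintype.card X := by
  classical
  suffices #{h : X → Fin q | ∀ x ∈ D, ∃ y ∈ E x, h y = h x} * q ^ #D ≤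
      k ^ #D * q ^ Fintype.card X from
    (Nat.mul_le_mul_right _ (card_le_card fun h hh => mem_filter.2 ⟨mem_univ _, hF h hh⟩)).trans
      this
  clear hF F
  induction D using Finset.induction_on_max_value rk with
  | empty => simp
  | insert a s ha hmax ih =>
    set A : Finset (X → Fin q) := {h | ∀ x ∈ s, ∃ y ∈ E x, h y = h x} with hA
    set A' : Finset (X → Fin q) := {h | ∀ x ∈ insert a s, ∃ y ∈ E x, h y = h x} with hA'
    have hch : ∀ h : X → Fin q, ∃ y, h ∈ A' → y ∈ E a ∧ h y = h a := by
      intro h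
      by_cases hh : h ∈ A'
      · obtain ⟨y, hy⟩ := (mem_filter.1 hh).2 a (mem_insert_self a s)
        exact ⟨y, fun _ => hy⟩
      · exact ⟨a, fun h' => absurd h' hh⟩
    choose y hy using hch
    -- Overwriting the value at the top-ranked `a` loses nothing once the witness `y h` is recorded:
    -- `y h` has smaller rank, so its value survives and equals `h a`. The conditions at `s` survive
    -- because their witnesses also rank below `a`.
    have key : #(A' ×ˢ (univ : Finset (Fin q))) ≤ #(E a ×ˢ A) := by
      refine card_le_card_of_injOn (fun z => (y z.1, Function.update z.1 a z.2)) ?_ ?_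
      · rintro ⟨h, c⟩ hz
        have hh : h ∈ A' := (mem_product.1 (mem_coe.1 hz)).1
        refine mem_coe.2 (mem_product.2 ⟨(hy h hh).1, mem_filter.2 ⟨mem_univ _, fun x hx => ?_⟩⟩)
        obtain ⟨w, hw, hwx⟩ := (mem_filter.1 hh).2 x (mem_insert_of_mem hx)
        have hxa : x ≠ a := fun e => ha (e ▸ hx)
        have hwa : w ≠ a := by
          rintro rfl
          exact absurd (hE x w hw) (not_lt.2 (hmax x hx))
        exact ⟨w, hw, by simpa [Function.update_of_ne hxa, Function.update_of_ne hwa] using hwx⟩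
      · rintro ⟨h, c⟩ hz ⟨h', c'⟩ hz' heq
        have hh : h ∈ A' := (mem_product.1 (mem_coe.1 hz)).1
        have hh' : h' ∈ A' := (mem_product.1 (mem_coe.1 hz')).1
        simp only [Prod.mk.injEq] at heq
        obtain ⟨h1, h2⟩ := heq
        have hya : y h ≠ a := fun e => absurd (hE a _ (hy h hh).1) (by rw [e]; exact lt_irrefl _)
        have hc : c = c' := by simpa using congrFun h2 a
        have hoff : ∀ x, x ≠ a → h x = h' x := fun x hx => by
          simpa [Function.update_of_ne hx] using congrFun h2 x
        have ha' : h a = h' a := by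
          rw [← (hy h hh).2, ← (hy h' hh').2, ← h1, hoff _ hya]
        have : h = h' := funext fun x => if hx : x = a then hx ▸ ha' else hoff x hx
        rw [this, hc]
    rw [card_product, card_product, card_univ, Fintype.card_fin] at key
    rw [card_insert_of_notMem ha, pow_succ, pow_succ]
    calc #A' * (q ^ #s * q) = (#A' * q) * q ^ #s := by ring
      _ ≤ (#(E a) * #A) * q ^ #s := Nat.mul_le_mul_right _ key
      _ ≤ (k * #A) * q ^ #s := by gcongr; exact hk a
      _ = k * (#A * q ^ #s) := by ring
      _ ≤ k * (k ^ #s * q ^ Fintype.card X) := by gcongr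
      _ = _ := by ring

open Finset in
/-- At most half of the elements with a collision are the first ones of their classes. -/
theorem card_colliding_le {N q : ℕ} (S : Finset (Fin N)) (f : Fin N → Fin q) :
    #{v ∈ S | ∃ w ∈ S, w ≠ v ∧ f w = f v} ≤ 2 * #{v ∈ S | ∃ w ∈ S, w < v ∧ f w = f v} := by
  classical
  set C := {v ∈ S | ∃ w ∈ S, w ≠ v ∧ f w = f v}
  set D := {v ∈ S | ∃ w ∈ S, w < v ∧ f w = f v}
  have hDC : D ⊆ C := fun v hv => by
    obtain ⟨hv, w, hw, hlt, he⟩ := by simpa [D] using hv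
    simp only [C, mem_filter]
    exact ⟨hv, w, hw, hlt.ne, he⟩
  -- The first element of a class is sent to a later one of the same class. A class has only one
  -- first element, so this is injective.
  have h1 : #(C \ D) ≤ #D := by
    have hch : ∀ v, ∃ w, v ∈ C \ D → w ∈ D ∧ f w = f v := by
      intro v
      by_cases hv : v ∈ C \ D
      · obtain ⟨hvC, hvD⟩ := mem_sdiff.1 hv
        obtain ⟨hvS, w, hw, hne, he⟩ := by simpa [C] using hvC
        rcases lt_or_gt_of_ne hne with h | h
        · exact absurd (mem_filter.2 ⟨hvS, w, hw, h, he⟩) hvD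
        · exact ⟨w, fun _ => ⟨mem_filter.2 ⟨hw, v, hvS, h, he.symm⟩, he⟩⟩
      · exact ⟨v, fun h => absurd h hv⟩
    choose g hg using hch
    refine card_le_card_of_injOn g (fun v hv => (hg v hv).1) ?_
    intro v hv v' hv' he
    have hf : f v = f v' := by rw [← (hg v hv).2, ← (hg v' hv').2, he]
    have hmem : ∀ z ∈ C \ D, z ∈ S ∧ ∀ w ∈ S, w < z → f w ≠ f z := fun z hz => by
      obtain ⟨hzC, hzD⟩ := mem_sdiff.1 hz
      have hzS := (mem_filter.1 hzC).1
      exact ⟨hzS, fun w hw hlt he => hzD (mem_filter.2 ⟨hzS, w, hw, hlt, he⟩)⟩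
    rcases lt_trichotomy v v' with h | h | h
    · exact absurd hf ((hmem v' hv').2 v (hmem v hv).1 h)
    · exact h
    · exact absurd hf.symm ((hmem v hv).2 v' (hmem v' hv').1 h)
  have h2 := card_sdiff_add_card_eq_card hDC
  omega

open Finset in
/-- A family of logarithmically many hash functions such that on each set of at most `k`
identifiers the average function has few collisions. -/
theorem exists_hash_family (N k B q : ℕ) (hk : 0 < k) (hB : B = 2 ^ 64)
    (hq : q = B * k) :
    ∃ h : Fin (Nat.log 2 N + 1) → Fin N → Fin q, ∀ S : Finset (Fin N), #S ≤ k →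
      8 * ∑ j, #{v ∈ S | ∃ w ∈ S, w ≠ v ∧ h j w = h j v} ≤ (Nat.log 2 N + 1) * k := by
  classical
  set L := Nat.log 2 N + 1 with hL
  have hqpos : 0 < q := by rw [hq, hB]; positivity
  have hLpos : 0 < L := Nat.succ_pos _
  -- A union bound: if every family fails, each lies in `rep f D` for some enumeration `f` of a bad
  -- set and some `D` of at least `L * k / 16` non-first colliding pairs. There are at most `2 ^ (2
  -- * (L * k))` such `(f, D)`, and each covers at most a fraction `2 ^ (-4 * (L * k))` of all
  -- families.
  by_contra! hcon
  let E : (Fin k → Fin N) → Fin L × Fin N → Finset (Fin L × Fin N) :=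
    fun f x => {z | z.1 = x.1 ∧ z.2 ∈ univ.image f ∧ z.2 < x.2}
  have hmemE : ∀ f x z, z ∈ E f x ↔ z.1 = x.1 ∧ z.2 ∈ univ.image f ∧ z.2 < x.2 :=
    fun f x z => by simp [E]
  obtain ⟨rep, hmem⟩ : ∃ rep : (Fin k → Fin N) → Finset (Fin L × Fin N) →
      Finset (Fin L × Fin N → Fin q),
      ∀ f D h, h ∈ rep f D ↔ ∀ x ∈ D, ∃ y ∈ E f x, h y = h x :=
    ⟨fun f D => {h | ∀ x ∈ D, ∃ y ∈ E f x, h y = h x}, fun f D h => by simp⟩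
  let Ds : (Fin k → Fin N) → Finset (Finset (Fin L × Fin N)) :=
    fun f => {D ∈ ((univ : Finset (Fin L)) ×ˢ univ.image f).powerset | L * k ≤ 16 * #D}
  -- Each forced repetition costs a factor `k / q = 1 / B`. With `B = 2 ^ 64` and `#D ≥ L * k / 16`,
  -- the exponent is `64 / 16 = 4`.
  have hrep : ∀ f D, D ∈ Ds f → #(rep f D) * 2 ^ (4 * (L * k)) ≤ q ^ (L * N) := by
    intro f D hD
    have hD' : L * k ≤ 16 * #D := (mem_filter.1 hD).2
    have hE : ∀ x, #(E f x) ≤ k := fun x => by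
      calc _ ≤ #(univ.image f) := by
            refine card_le_card_of_injOn Prod.snd (fun z hz => ((hmemE f x z).1 hz).2.1) ?_
            intro z hz z' hz' he
            exact Prod.ext (((hmemE f x z).1 hz).1.trans ((hmemE f x z').1 hz').1.symm) he
        _ ≤ k := card_image_le.trans (by simp)
    have h1 := card_repeating_mul_pow_le (fun x : Fin L × Fin N => (x.2 : ℕ)) (E f)
      (fun x y hy => ((hmemE f x y).1 hy).2.2) k q hE D (rep f D) (fun h hh => (hmem f D h).1 hh)
    have hqD : q ^ #D = B ^ #D * k ^ #D := by rw [hq, mul_pow]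
    have h2 : #(rep f D) * B ^ #D * k ^ #D ≤ q ^ (L * N) * k ^ #D := by
      calc _ = #(rep f D) * q ^ #D := by rw [hqD]; ring
        _ ≤ k ^ #D * q ^ Fintype.card (Fin L × Fin N) := h1
        _ = _ := by simp [mul_comm]
    have h3 := Nat.le_of_mul_le_mul_right h2 (by positivity)
    refine le_trans (Nat.mul_le_mul_left _ ?_) h3
    rw [hB, ← pow_mul]
    exact Nat.pow_le_pow_right (by norm_num) (by omega)
  have hcover : (univ : Finset (Fin L × Fin N → Fin q)) ⊆
      univ.biUnion fun f : Fin k → Fin N => (Ds f).biUnion fun D => rep f D := by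
    intro h _
    obtain ⟨S, hS, hlt⟩ := hcon (fun j v => h (j, v))
    have hne : S.Nonempty := by
      rw [nonempty_iff_ne_empty]
      rintro rfl
      simp at hlt
    obtain ⟨f, hf⟩ : ∃ f : Fin k → Fin N, univ.image f = S := by
      obtain ⟨s₀, hs₀⟩ := hne
      let e := S.equivFin.symm
      refine ⟨fun i => if hi : i.1 < #S then (e ⟨i.1, hi⟩).1 else s₀, ?_⟩
      ext v
      simp only [mem_image, mem_univ, true_and]
      constructor
      · rintro ⟨i, rfl⟩
        split_ifs
        · exact (e _).2
        · exact hs₀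
      · intro hv
        refine ⟨⟨(S.equivFin ⟨v, hv⟩).1, (S.equivFin ⟨v, hv⟩).2.trans_le hS⟩, ?_⟩
        simp [e]
    let D : Finset (Fin L × Fin N) :=
      {x | x.2 ∈ S ∧ ∃ w ∈ S, w < x.2 ∧ h (x.1, w) = h x}
    have hcard : #D = ∑ j, #{v ∈ S | ∃ w ∈ S, w < v ∧ h (j, w) = h (j, v)} := by
      rw [card_eq_sum_card_fiberwise (f := Prod.fst) (t := univ) (fun _ _ => mem_coe.2 (mem_univ _))]
      refine sum_congr rfl fun j _ => ?_
      refine card_bij (fun x _ => x.2) ?_ ?_ ?_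
      · rintro ⟨j', v⟩ hx
        obtain ⟨hx, rfl⟩ := mem_filter.1 hx
        simpa [D] using hx
      · rintro ⟨j₁, v₁⟩ h₁ ⟨j₂, v₂⟩ h₂ he
        exact Prod.ext ((mem_filter.1 h₁).2.trans (mem_filter.1 h₂).2.symm) he
      · intro v hv
        exact ⟨(j, v), by simpa [D] using hv, rfl⟩
    have hbig : L * k ≤ 16 * #D := by
      have : ∑ j, #{v ∈ S | ∃ w ∈ S, w ≠ v ∧ h (j, w) = h (j, v)} ≤ 2 * #D := by
        rw [hcard, mul_sum]
        exact sum_le_sum fun j _ => card_colliding_le S fun v => h (j, v)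
      omega
    simp only [mem_biUnion, mem_univ, true_and]
    refine ⟨f, D, mem_filter.2 ⟨mem_powerset.2 fun x hx => ?_, hbig⟩, ?_⟩
    · rw [hf]
      exact mem_product.2 ⟨mem_univ _, (mem_filter.1 hx).2.1⟩
    · refine (hmem f D h).2 fun x hx => ?_
      obtain ⟨-, w, hw, hlt, he⟩ := (mem_filter.1 hx).2
      exact ⟨(x.1, w), (hmemE f x _).2 ⟨rfl, hf ▸ hw, hlt⟩, he⟩
  have hDs : ∀ f, #(Ds f) ≤ 2 ^ (L * k) := by
    intro f
    refine (card_filter_le _ _).trans ?_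
    rw [card_powerset, card_product]
    refine Nat.pow_le_pow_right (by norm_num) ?_
    simp only [card_univ, Fintype.card_fin]
    exact Nat.mul_le_mul_left _ (card_image_le.trans (by simp))
  have htotal : q ^ (L * N) * 2 ^ (4 * (L * k)) ≤ 2 ^ (2 * (L * k)) * q ^ (L * N) := by
    have h1 : q ^ (L * N) ≤ ∑ f : Fin k → Fin N, ∑ D ∈ Ds f, #(rep f D) := by
      calc q ^ (L * N) = #(univ : Finset (Fin L × Fin N → Fin q)) := by simp
        _ ≤ _ := card_le_card hcover
        _ ≤ _ := card_biUnion_le.trans (sum_le_sum fun f _ => card_biUnion_le)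
    have hN : N ^ k ≤ 2 ^ (L * k) := by
      rw [pow_mul]
      exact Nat.pow_le_pow_left (Nat.lt_pow_succ_log_self (by norm_num) N).le k
    calc _ ≤ (∑ f : Fin k → Fin N, ∑ D ∈ Ds f, #(rep f D)) * 2 ^ (4 * (L * k)) := by gcongr
      _ = ∑ f : Fin k → Fin N, ∑ D ∈ Ds f, #(rep f D) * 2 ^ (4 * (L * k)) := by
          simp only [sum_mul]
      _ ≤ ∑ f : Fin k → Fin N, ∑ D ∈ Ds f, q ^ (L * N) := by
          gcongr with f _ D hD
          exact hrep f D hD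
      _ ≤ ∑ f : Fin k → Fin N, 2 ^ (L * k) * q ^ (L * N) := by
          gcongr with f _
          rw [sum_const, smul_eq_mul]
          gcongr
          exact hDs f
      _ = N ^ k * (2 ^ (L * k) * q ^ (L * N)) := by simp
      _ ≤ 2 ^ (L * k) * (2 ^ (L * k) * q ^ (L * N)) := by gcongr
      _ = _ := by rw [two_mul, pow_add]; ring
  have hpos : 0 < q ^ (L * N) := by positivity
  rw [mul_comm] at htotal
  have hle := Nat.le_of_mul_le_mul_right htotal hpos
  have := (Nat.pow_le_pow_iff_right (by norm_num)).1 hle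
  have : 0 < L * k := by positivity
  omega

/-! ### The grid, the dilution and lattice sums of interference -/

namespace SINRParams

theorem α_pos (P : SINRParams) : 0 < P.α := by linarith [P.two_lt_α]

theorem threshold_pos (P : SINRParams) : 0 < (1 + P.ε) * P.β * P.noise := by
  have := P.ε_pos
  have := P.one_le_β
  have := P.one_le_noise
  positivity

theorem range_pos (P : SINRParams) : 0 < P.range :=
  Real.rpow_pos_of_pos (div_pos P.power_pos P.threshold_pos) _

theorem range_rpow (P : SINRParams) :
    P.range ^ P.α = P.power / ((1 + P.ε) * P.β * P.noise) := by
  rw [range, ← Real.rpow_mul (div_pos P.power_pos P.threshold_pos).le, one_div,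
    inv_mul_cancel₀ P.α_pos.ne', Real.rpow_one]

/-- The side length of the boxes of the grid. -/
noncomputable def side (P : SINRParams) : ℝ := P.range / 2

theorem side_pos (P : SINRParams) : 0 < P.side := half_pos P.range_pos

/-- The box of the grid that contains a point. -/
noncomputable def box (P : SINRParams) (x : Plane) : Fin 2 → ℤ := fun i => ⌊x i / P.side⌋

theorem abs_sub_le_dist (x y : Plane) (i : Fin 2) : |x i - y i| ≤ dist x y := by
  rw [dist_eq_norm, ← Real.norm_eq_abs, ← PiLp.sub_apply]
  exact PiLp.norm_apply_le (x - y) i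

theorem norm_box_sub_box_le (P : SINRParams) (x y : Plane) :
    ‖P.box x - P.box y‖ ≤ dist x y / P.side + 1 := by
  have hs := P.side_pos
  refine (pi_norm_le_iff_of_nonneg (by positivity)).2 fun i => ?_
  have h1 : |x i / P.side - y i / P.side| ≤ dist x y / P.side := by
    rw [← sub_div, abs_div, abs_of_pos hs]
    exact div_le_div_of_nonneg_right (abs_sub_le_dist x y i) hs.le
  rw [abs_le] at h1
  simp only [box, Pi.sub_apply, Int.norm_eq_abs, Int.cast_sub]
  rw [abs_le]
  have a1 := Int.floor_le (x i / P.side)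
  have a2 := Int.lt_floor_add_one (x i / P.side)
  have b1 := Int.floor_le (y i / P.side)
  have b2 := Int.lt_floor_add_one (y i / P.side)
  constructor <;> linarith

theorem abs_box_sub_box_le_two (P : SINRParams) {x y : Plane} (h : dist x y ≤ P.range)
    (i : Fin 2) : |P.box x i - P.box y i| ≤ 2 := by
  have hs := P.side_pos
  have h1 : |x i / P.side - y i / P.side| ≤ 2 := by
    rw [← sub_div, abs_div, abs_of_pos hs, div_le_iff₀ hs]
    refine (abs_sub_le_dist x y i).trans (h.trans ?_)
    rw [side]
    linarith
  rw [abs_le] at h1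
  have a1 := Int.floor_le (x i / P.side)
  have a2 := Int.lt_floor_add_one (x i / P.side)
  have b1 := Int.floor_le (y i / P.side)
  have b2 := Int.lt_floor_add_one (y i / P.side)
  have c1 : ((P.box x i - P.box y i : ℤ) : ℝ) < 3 := by
    simp only [box, Int.cast_sub]
    linarith
  have c2 : ((P.box y i - P.box x i : ℤ) : ℝ) < 3 := by
    simp only [box, Int.cast_sub]
    linarith
  have c1' : P.box x i - P.box y i < 3 := by exact_mod_cast c1
  have c2' : P.box y i - P.box x i < 3 := by exact_mod_cast c2
  rw [abs_le]
  omega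

/-- The diagonal `√2 * side` is below `2 * side`, the range: each box is a clique. -/
theorem dist_le_range_of_box_eq (P : SINRParams) {x y : Plane} (h : P.box x = P.box y) :
    dist x y ≤ P.range := by
  have hs := P.side_pos
  have hi : ∀ i, dist (x i) (y i) ^ 2 ≤ P.side ^ 2 := fun i => by
    have h1 := Int.abs_sub_lt_one_of_floor_eq_floor (congrFun h i)
    rw [← sub_div, abs_div, abs_of_pos hs, div_lt_one hs, ← Real.dist_eq] at h1
    exact pow_le_pow_left₀ dist_nonneg h1.le 2
  refine le_of_sq_le_sq ?_ P.range_pos.le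
  rw [EuclideanSpace.dist_sq_eq, Fin.sum_univ_two]
  have h0 := hi 0
  have h1 := hi 1
  have : P.range = 2 * P.side := by rw [side]; ring
  rw [this]
  nlinarith [sq_nonneg P.side]

/-- The sum is a fixed multiple of `d ^ (-α)` and tends to `0`. The factor `1 / 8` is the reserve
spent on hashed transmissions. The bound `7` serves `eq_of_classOf_eq` (more than `4`) and
`Network.signal_le_weight` (at least `6`). -/
theorem exists_dilution (P : SINRParams) : ∃ d : ℕ, 7 ≤ d ∧
    ∑' z : Fin 2 → ℤ, P.power * (2 / (P.side * d)) ^ P.α * ‖z‖ ^ (-P.α) ≤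
      P.ε * P.noise / 8 := by
  have hs := P.side_pos
  have hpos : 0 < P.ε * P.noise / 8 := by
    have := P.ε_pos
    have := P.one_le_noise
    positivity
  have hlim : Filter.Tendsto (fun d : ℕ =>
      P.power * (2 / (P.side * d)) ^ P.α * ∑' z : Fin 2 → ℤ, ‖z‖ ^ (-P.α))
      Filter.atTop (nhds 0) := by
    have h1 : Filter.Tendsto (fun d : ℕ => 2 / (P.side * d)) Filter.atTop (nhds 0) :=
      (tendsto_natCast_atTop_atTop.const_mul_atTop hs).const_div_atTop 2
    have h2 := h1.rpow_const (p := P.α) (Or.inr P.α_pos.le)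
    rw [Real.zero_rpow P.α_pos.ne'] at h2
    simpa using (h2.const_mul P.power).mul_const (∑' z : Fin 2 → ℤ, ‖z‖ ^ (-P.α))
  obtain ⟨d, hd7, hd⟩ := ((Filter.eventually_ge_atTop 7).and
    (hlim.eventually (gt_mem_nhds hpos))).exists
  exact ⟨d, hd7, by rw [tsum_mul_left]; exact hd.le⟩

/-- Boxes are processed in parallel when they agree modulo this number. -/
noncomputable def dilution (P : SINRParams) : ℕ := P.exists_dilution.choose

theorem seven_le_dilution (P : SINRParams) : 7 ≤ P.dilution := P.exists_dilution.choose_spec.1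

instance (P : SINRParams) : NeZero P.dilution := ⟨by have := P.seven_le_dilution; omega⟩

/-- The classes of boxes that are processed in parallel. -/
abbrev BoxClass (P : SINRParams) : Type := Fin 2 → ZMod P.dilution

/-- The class of a box. -/
noncomputable def classOf (P : SINRParams) (b : Fin 2 → ℤ) : P.BoxClass := fun i => (b i : ZMod P.dilution)

theorem dilution_dvd_sub {P : SINRParams} {b b' : Fin 2 → ℤ} (h : P.classOf b = P.classOf b')
    (i : Fin 2) : (P.dilution : ℤ) ∣ b' i - b i :=
  (ZMod.intCast_eq_intCast_iff_dvd_sub _ _ _).1 (congrFun h i)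

/-- An edge changes each box coordinate by at most `2`, so boxes reached from a common box differ by
at most `4`, less than the dilution. -/
theorem eq_of_classOf_eq {P : SINRParams} {b b' : Fin 2 → ℤ} (h : P.classOf b = P.classOf b')
    (hle : ∀ i, |b' i - b i| ≤ 4) : b = b' := by
  funext i
  have h7 : (7 : ℤ) ≤ P.dilution := by exact_mod_cast P.seven_le_dilution
  have := Int.eq_zero_of_abs_lt_dvd (dilution_dvd_sub h i) ((hle i).trans_lt (by omega))
  omega

theorem dilution_le_norm {P : SINRParams} {b b' : Fin 2 → ℤ} (h : P.classOf b = P.classOf b')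
    (hne : b ≠ b') : (P.dilution : ℝ) ≤ ‖b' - b‖ := by
  obtain ⟨i, hi⟩ := Function.ne_iff.1 hne
  refine le_trans ?_ (norm_le_pi_norm (b' - b) i)
  rw [Pi.sub_apply, Int.norm_eq_abs]
  have h1 := Int.le_of_dvd (abs_pos.2 (sub_ne_zero.2 hi.symm))
    ((dvd_abs _ _).2 (dilution_dvd_sub h i))
  exact_mod_cast h1

/-- A bound on the power of a signal from the distance `m` in boxes. -/
noncomputable def weight (P : SINRParams) (m : ℝ) : ℝ := P.power * (2 / (P.side * m)) ^ P.α

theorem weight_nonneg (P : SINRParams) {m : ℝ} (hm : 0 ≤ m) : 0 ≤ P.weight m := by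
  have := P.side_pos
  have := P.power_pos
  rw [weight]
  positivity

open Finset in
/-- Transmitters in boxes of one class cause bounded interference. -/
theorem sum_weight_le (P : SINRParams) {V : Type*} (A : Finset V) (f : V → Fin 2 → ℤ)
    (b : Fin 2 → ℤ) (hA : ∀ w ∈ A, P.classOf b = P.classOf (f w)) (k : ℕ)
    (hk : ∀ b', #{w ∈ A | f w = b'} ≤ k) :
    ∑ w ∈ A, P.weight ‖f w - b‖ ≤ k * (P.ε * P.noise / 8) := by
  classical
  have hs := P.side_pos
  have hp := P.power_pos
  set d := P.dilution with hd
  let g : V → Fin 2 → ℤ := fun w i => (f w i - b i) / d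
  let F : (Fin 2 → ℤ) → ℝ := fun z => P.power * (2 / (P.side * d)) ^ P.α * ‖z‖ ^ (-P.α)
  have hFnn : ∀ z, 0 ≤ F z := fun z => by positivity
  -- Within a class, offsets are `d` times lattice vectors, so the weights become terms of the
  -- series that fixed `d`.
  have hg : ∀ w ∈ A, f w - b = (d : ℤ) • g w := fun w hw => by
    funext i
    simp only [Pi.sub_apply, Pi.smul_apply, smul_eq_mul, g]
    exact (Int.mul_ediv_cancel' (dilution_dvd_sub (hA w hw) i)).symm
  have hFw : ∀ w ∈ A, P.weight ‖f w - b‖ = F (g w) := fun w hw => by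
    have h1 : ‖f w - b‖ = d * ‖g w‖ := by rw [hg w hw, norm_smul]; simp
    have h2 : 2 / (P.side * (d * ‖g w‖)) = 2 / (P.side * d) * ‖g w‖⁻¹ := by
      rw [← mul_assoc, ← div_div, div_eq_mul_inv (2 / (P.side * d))]
    simp only [F, weight]
    rw [h1, h2, Real.mul_rpow (by positivity) (by positivity), Real.inv_rpow (norm_nonneg _),
      Real.rpow_neg (norm_nonneg _), mul_assoc]
  rw [sum_congr rfl hFw, sum_comp F g]
  -- Here `α > 2` enters: it is the condition for convergence over the planar lattice.
  have hsum : Summable F := (EisensteinSeries.summable_one_div_norm_rpow P.two_lt_α).mul_left _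
  calc ∑ z ∈ A.image g, #{w ∈ A | g w = z} • F z ≤ ∑ z ∈ A.image g, (k : ℝ) * F z := by
        refine sum_le_sum fun z _ => ?_
        rw [nsmul_eq_mul]
        refine mul_le_mul_of_nonneg_right ?_ (hFnn z)
        refine Nat.cast_le.2 ((card_le_card fun w hw => ?_).trans (hk (b + (d : ℤ) • z)))
        obtain ⟨hwA, hwz⟩ := mem_filter.1 hw
        exact mem_filter.2 ⟨hwA, by rw [← hwz, ← hg w hwA]; abel⟩
    _ = k * ∑ z ∈ A.image g, F z := by rw [mul_sum]
    _ ≤ k * (P.ε * P.noise / 8) := by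
        refine mul_le_mul_of_nonneg_left ?_ (Nat.cast_nonneg k)
        exact (hsum.sum_le_tsum _ fun z _ => hFnn z).trans P.exists_dilution.choose_spec.2

end SINRParams

/-! ### Reception in the SINR model -/

namespace Network

variable {N : ℕ} {V : Type}

/-- The box of a station. -/
noncomputable def box (P : SINRParams) (net : Network N V) (v : V) : Fin 2 → ℤ :=
  P.box (net.pos v)

/-- The class of the box of a station. -/
noncomputable def boxClass (P : SINRParams) (net : Network N V) (v : V) : P.BoxClass :=
  P.classOf (net.box P v)

variable {P : SINRParams} {net : Network N V}

theorem adj_of_box_eq {u v : V} (hne : u ≠ v) (h : net.box P u = net.box P v) :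
    (net.graph P).Adj u v :=
  ⟨hne, P.dist_le_range_of_box_eq h⟩

theorem abs_box_sub_le_two {u v : V} (h : (net.graph P).Adj u v) (i : Fin 2) :
    |net.box P u i - net.box P v i| ≤ 2 :=
  P.abs_box_sub_box_le_two h.2 i

theorem box_eq_of_adj_adj {u v w : V} (hv : (net.graph P).Adj u v) (hw : (net.graph P).Adj u w)
    (h : net.boxClass P v = net.boxClass P w) : net.box P v = net.box P w := by
  refine SINRParams.eq_of_classOf_eq h fun i => ?_
  have h1 := abs_le.1 (abs_box_sub_le_two hv i)
  have h2 := abs_le.1 (abs_box_sub_le_two hw i)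
  rw [abs_le]
  constructor <;> linarith [h1.1, h1.2, h2.1, h2.2]

theorem box_eq_of_adj {u v : V} (hv : (net.graph P).Adj u v)
    (h : net.boxClass P u = net.boxClass P v) : net.box P u = net.box P v := by
  refine SINRParams.eq_of_classOf_eq h fun i => ?_
  rw [abs_sub_comm]
  exact (abs_box_sub_le_two hv i).trans (by norm_num)

/-- Replacing the box of `v` by that of `u` loses `2`, and replacing box offset by distance loses
`1`; `m ≥ 7` gives `m - 3 ≥ m / 2`. The resulting bound no longer depends on the listener. -/
theorem signal_le_weight {u v w : V} (hu : ∀ i, |net.box P u i - net.box P v i| ≤ 2)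
    (hc : net.boxClass P v = net.boxClass P w) (hne : net.box P v ≠ net.box P w) :
    net.signal P w u ≤ P.weight ‖net.box P w - net.box P v‖ := by
  have hs := P.side_pos
  set m := ‖net.box P w - net.box P v‖ with hm
  have h7 : (7 : ℝ) ≤ m :=
    le_trans (by exact_mod_cast P.seven_le_dilution) (SINRParams.dilution_le_norm hc hne)
  have hu2 : ‖net.box P u - net.box P v‖ ≤ 2 :=
    (pi_norm_le_iff_of_nonneg (by norm_num)).2 fun i => by
      rw [Pi.sub_apply, Int.norm_eq_abs]
      exact_mod_cast hu i
  have h1 : m ≤ ‖net.box P w - net.box P u‖ + 2 := by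
    calc m = ‖(net.box P w - net.box P u) + (net.box P u - net.box P v)‖ := by rw [hm]; congr 1; abel
      _ ≤ _ := (norm_add_le _ _).trans (by linarith)
  have h2 := P.norm_box_sub_box_le (net.pos w) (net.pos u)
  have h3 : P.side * m / 2 ≤ dist (net.pos w) (net.pos u) := by
    have h4 : m / 2 ≤ dist (net.pos w) (net.pos u) / P.side := by
      have : ‖net.box P w - net.box P u‖ ≤ dist (net.pos w) (net.pos u) / P.side + 1 := h2
      linarith
    rw [le_div_iff₀ hs] at h4
    linarith
  have h5 : 0 < P.side * m / 2 := by positivity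
  rw [signal, SINRParams.weight, div_eq_mul_inv]
  refine mul_le_mul_of_nonneg_left ?_ P.power_pos.le
  rw [← Real.inv_rpow dist_nonneg]
  refine Real.rpow_le_rpow (inv_nonneg.2 dist_nonneg) ?_ P.α_pos.le
  rw [← inv_div]
  exact inv_anti₀ h5 h3

variable [Fintype V]

/-- Within range the signal is at least `(1 + ε) * β * noise`, so the sensitivity margin absorbs
interference up to `ε * noise`. -/
theorem hears_of_sum_le {u v : V} {T : Set V} (hv : v ∈ T) (hu : u ∉ T)
    (hadj : (net.graph P).Adj u v) (A : Finset V) (hA : ∀ w ∈ T, w ≠ v → w ∈ A)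
    (hsum : ∑ w ∈ A, net.signal P w u ≤ P.ε * P.noise) : net.Hears P v u T := by
  classical
  have hne : net.pos v ≠ net.pos u := fun h => hadj.1 (net.pos_injective h).symm
  have hd : 0 < dist (net.pos v) (net.pos u) := dist_pos.2 hne
  have hthr : (1 + P.ε) * P.β * P.noise ≤ net.signal P v u := by
    have h1 : dist (net.pos v) (net.pos u) ^ P.α ≤ P.range ^ P.α :=
      Real.rpow_le_rpow hd.le (by rw [dist_comm]; exact hadj.2) P.α_pos.le
    rw [P.range_rpow, le_div_iff₀ P.threshold_pos] at h1
    rw [signal, le_div_iff₀ (Real.rpow_pos_of_pos hd _)]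
    linarith
  refine ⟨hv, hu, ?_, hthr⟩
  have hle : ∑ w with w ∈ T ∧ w ≠ v, net.signal P w u ≤ P.ε * P.noise := by
    refine le_trans (Finset.sum_le_sum_of_subset_of_nonneg ?_ fun w _ _ => signal_nonneg P net w u)
      hsum
    intro w hw
    simp only [Finset.mem_filter, Finset.mem_univ, true_and] at hw
    exact hA w hw.1 hw.2
  have hnn : 0 ≤ ∑ w with w ∈ T ∧ w ≠ v, net.signal P w u :=
    Finset.sum_nonneg fun w _ => signal_nonneg P net w u
  have hn := P.one_le_noise
  have key : P.β ≤ net.signal P v u / (P.noise + ∑ w with w ∈ T ∧ w ≠ v, net.signal P w u) := by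
    rw [le_div_iff₀ (by linarith)]
    have hb := P.one_le_β
    nlinarith
  unfold sinr
  convert key

/-- The sensitivity condition alone forces the distance below the range, whatever the interference.
-/
theorem Hears.adj {u v : V} {T : Set V} (h : net.Hears P v u T) : (net.graph P).Adj u v := by
  have hne : u ≠ v := fun e => h.2.1 (e ▸ h.1)
  refine ⟨hne, ?_⟩
  have hd : 0 < dist (net.pos v) (net.pos u) :=
    dist_pos.2 fun e => hne (net.pos_injective e).symm
  have h1 := h.2.2.2
  rw [signal, le_div_iff₀ (Real.rpow_pos_of_pos hd _)] at h1
  rw [dist_comm]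
  rw [← Real.rpow_le_rpow_iff hd.le P.range_pos.le P.α_pos, P.range_rpow,
    le_div_iff₀ P.threshold_pos]
  linarith

variable {M : Type}

theorem heard_eq_of_hears {msg : V → Option M} {u v : V}
    (h : net.Hears P v u {w | (msg w).isSome}) : net.heard P msg u = msg v := by
  have hex : ∃ v, net.Hears P v u {w | (msg w).isSome} := ⟨v, h⟩
  rw [heard, dif_pos hex, hex.choose_spec.unique h]

theorem exists_adj_of_heard_eq_some {msg : V → Option M} {u : V} {x : M}
    (h : net.heard P msg u = some x) : ∃ v, (net.graph P).Adj u v ∧ msg v = some x := by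
  rw [heard] at h
  split_ifs at h with hex
  exact ⟨_, hex.choose_spec.adj, h⟩

/-- If the transmitters are in boxes of one class, at most one in each box, then each station hears
exactly the transmitters that are its neighbours. -/
theorem heard_eq_some_iff {msg : V → Option M} {c : P.BoxClass}
    (hc : ∀ v x, msg v = some x → net.boxClass P v = c)
    (hinj : ∀ v w x y, msg v = some x → msg w = some y → net.box P v = net.box P w → v = w)
    {u : V} {x : M} :
    net.heard P msg u = some x ↔ ∃ v, (net.graph P).Adj u v ∧ msg v = some x := by
  classical
  refine ⟨exists_adj_of_heard_eq_some, ?_⟩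
  rintro ⟨v, hadj, hv⟩
  rw [← hv]
  refine heard_eq_of_hears ?_
  -- A transmitting neighbour of `v` would be of the same class, hence in the box of `v`, where `v`
  -- is the only transmitter.
  have hu : u ∉ {w | (msg w).isSome} := by
    intro hu
    obtain ⟨y, hy⟩ := Option.isSome_iff_exists.1 hu
    exact hadj.1 (hinj u v y x hy hv (box_eq_of_adj hadj ((hc u y hy).trans (hc v x hv).symm)))
  refine hears_of_sum_le (by simp [hv]) hu hadj ({w | (msg w).isSome ∧ w ≠ v} : Finset V)
    (fun w hw hne => by simpa using ⟨hw, hne⟩) ?_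
  have hsum := P.sum_weight_le ({w | (msg w).isSome ∧ w ≠ v} : Finset V) (net.box P) (net.box P v)
    (fun w hw => by
      obtain ⟨y, hy⟩ := Option.isSome_iff_exists.1 (Finset.mem_filter.1 hw).2.1
      exact (hc v x hv).trans (hc w y hy).symm) 1 (fun b' => by
      rw [Finset.card_le_one]
      intro a ha a' ha'
      simp only [Finset.mem_filter, Finset.mem_univ, true_and] at ha ha'
      obtain ⟨y, hy⟩ := Option.isSome_iff_exists.1 ha.1.1
      obtain ⟨y', hy'⟩ := Option.isSome_iff_exists.1 ha'.1.1
      exact hinj a a' y y' hy hy' (ha.2.trans ha'.2.symm))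
  have hpos : 0 < P.ε * P.noise := mul_pos P.ε_pos (by linarith [P.one_le_noise])
  refine le_trans (Finset.sum_le_sum fun w hw => ?_) (hsum.trans (by push_cast; linarith))
  simp only [Finset.mem_filter, Finset.mem_univ, true_and] at hw
  obtain ⟨y, hy⟩ := Option.isSome_iff_exists.1 hw.1
  exact signal_le_weight (abs_box_sub_le_two hadj) ((hc v x hv).trans (hc w y hy).symm)
    fun e => hw.2 (hinj v w x y hv hy e).symm

end Network

/-! ### Composition of protocols by phases -/

namespace Protocol

variable {I M A O K : Type}

/-- The protocol without communication. -/
def silent (f : I → O) : Protocol I M O where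
  State := I
  rounds := 0
  init := id
  send _ := none
  step s _ := s
  output := f

open Classical in
/-- After `π`, run one round for each key in `K`, in which the transmissions depend only on the
outputs of `π` and on the key, and compute a new output from what was heard. -/
noncomputable def andThen [Fintype K] (π : Protocol I M A) (msg : A → K → Option M)
    (post : A → (K → Option M) → O) : Protocol I M O where
  State := ℕ × π.State × (K → Option M)
  rounds := π.rounds + Fintype.card K
  init i := (0, π.init i, fun _ => none)
  send s :=
    if s.1 < π.rounds then π.send s.2.1
    else if h : s.1 - π.rounds < Fintype.card K then
      msg (π.output s.2.1) ((Fintype.equivFin K).symm ⟨_, h⟩)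
    else none
  step s m :=
    if s.1 < π.rounds then (s.1 + 1, π.step s.2.1 m, s.2.2)
    else if h : s.1 - π.rounds < Fintype.card K then
      (s.1 + 1, s.2.1, Function.update s.2.2 ((Fintype.equivFin K).symm ⟨_, h⟩) m)
    else s
  output s := post (π.output s.2.1) s.2.2

variable {N : ℕ} {V : Type} [Fintype V] (P : SINRParams) (net : Network N V) (input : V → I)

theorem run_silent (f : I → O) (v : V) :
    (silent f : Protocol I M O).run P net input v = f (input v) := (rfl)

variable [Fintype K] (π : Protocol I M A) (msg : A → K → Option M) (post : A → (K → Option M) → O)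

theorem stateAt_andThen_of_le {t : ℕ} (ht : t ≤ π.rounds) :
    (π.andThen msg post).stateAt P net input t =
      fun v => (t, π.stateAt P net input t v, fun _ => none) := by
  induction t with
  | zero => rfl
  | succ t ih =>
    have ht' : t < π.rounds := ht
    funext v
    rw [stateAt, ih ht'.le]
    simp only [andThen, ht', if_true]
    rfl

/-- Round `j` of the phase fills only the table entry of the key numbered `j`, while the state of
`π` stays frozen; transmissions never depend on earlier rounds of the same phase. -/
theorem stateAt_andThen_add {j : ℕ} (hj : j ≤ Fintype.card K) :
    (π.andThen msg post).stateAt P net input (π.rounds + j) =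
      fun v => (π.rounds + j, π.stateAt P net input π.rounds v, fun κ =>
        if (Fintype.equivFin K κ).1 < j then
          net.heard P (fun w => msg (π.run P net input w) κ) v else none) := by
  classical
  induction j with
  | zero => simpa using stateAt_andThen_of_le P net input π msg post le_rfl
  | succ j ih =>
    have hj' : j < Fintype.card K := hj
    funext v
    rw [← add_assoc, stateAt, ih hj'.le]
    simp only [andThen, Nat.not_lt.2 (Nat.le_add_right _ _), if_false, Nat.add_sub_cancel_left,
      dif_pos hj']
    congr 2
    funext κ
    by_cases hκ : κ = (Fintype.equivFin K).symm ⟨j, hj'⟩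
    · subst hκ
      simp [run]
    · rw [Function.update_of_ne hκ]
      have hne : (Fintype.equivFin K κ).1 ≠ j := fun h => hκ <| by
        rw [Equiv.eq_symm_apply]
        exact Fin.ext h
      have : (Fintype.equivFin K κ).1 < j + 1 ↔ (Fintype.equivFin K κ).1 < j := by omega
      simp only [this]

/-- This reduces the analysis of each phase to a static question: what is heard in the round of each
key. -/
theorem run_andThen (v : V) :
    (π.andThen msg post).run P net input v = post (π.run P net input v)
      fun κ => net.heard P (fun w => msg (π.run P net input w) κ) v := by
  have h := congrFun (stateAt_andThen_add P net input π msg post le_rfl) v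
  rw [run]
  change (π.andThen msg post).output
    ((π.andThen msg post).stateAt P net input (π.rounds + Fintype.card K) v) = _
  rw [h]
  simp only [Fin.is_lt, if_true]
  rfl

end Protocol

/-! ### Reception under hashed transmissions -/

namespace Network

variable {N : ℕ} {V : Type} [Fintype V] {P : SINRParams} {net : Network N V}

open Finset Classical in
/-- When the stations of `S`, at most `k` in each box, transmit according to a family of hash
functions with few collisions, all but `k / 4` stations of `S` in each box succeed in being heard
by all other stations of the box. -/
theorem four_mul_card_unheard_le {M : Type} {k L q : ℕ} (hL : 0 < L)
    (h : Fin L → Fin N → Fin q)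
    (hh : ∀ S : Finset (Fin N), #S ≤ k →
      8 * ∑ j, #{v ∈ S | ∃ w ∈ S, w ≠ v ∧ h j w = h j v} ≤ L * k)
    (S : Set V) (hS : ∀ b, #{v | v ∈ S ∧ net.box P v = b} ≤ k) (enc : Fin N → M)
    (b : Fin 2 → ℤ) (B : Finset V) (hBS : ∀ v ∈ B, v ∈ S) (hBb : ∀ v ∈ B, net.box P v = b)
    (hB : ∀ v ∈ B, ∀ j, ∃ u, net.box P u = net.box P v ∧ u ≠ v ∧
      net.heard P (fun w => if w ∈ S ∧ net.boxClass P w = net.boxClass P v ∧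
        h j (net.id w) = h j (net.id v) then some (enc (net.id w)) else none) u ≠
      some (enc (net.id v))) :
    4 * #B ≤ k := by
  set η := P.ε * P.noise / 8 with hη
  have hηpos : 0 < η := by
    have := P.ε_pos
    have := P.one_le_noise
    positivity
  set W : Finset V := {w | w ∈ S ∧ net.boxClass P w = P.classOf b ∧ net.box P w ≠ b} with hW
  let wt : V → ℝ := fun w => P.weight ‖net.box P w - b‖
  have hwt : ∀ w, 0 ≤ wt w := fun w => P.weight_nonneg (norm_nonneg _)
  have hWsum : ∑ w ∈ W, wt w ≤ k * η :=
    P.sum_weight_le W (net.box P) b (fun w hw => (mem_filter.1 hw).2.2.1.symm) k fun b' =>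
      (card_le_card fun w hw => by
        simp only [hW, mem_filter, mem_univ, true_and] at hw ⊢
        exact ⟨hw.1.1, hw.2⟩).trans (hS b')
  set Sb : Finset V := {v | v ∈ S ∧ net.box P v = b} with hSb
  have hBSb : B ⊆ Sb := fun v hv => mem_filter.2 ⟨mem_univ _, hBS v hv, hBb v hv⟩
  let iso : Fin L → V → Prop := fun j v => ∀ w ∈ Sb, w ≠ v → h j (net.id w) ≠ h j (net.id v)
  -- A station with no collision in its own box can only fail through the other boxes of its class,
  -- and these must then exceed the margin `ε * noise = 8 * η`.
  have hX : ∀ j, ∀ v ∈ B, iso j v →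
      8 * η < ∑ w ∈ W with h j (net.id w) = h j (net.id v), wt w := by
    intro j v hv hiso
    by_contra! hle
    obtain ⟨u, hu, huv, hheard⟩ := hB v hv j
    have hvb := hBb v hv
    refine hheard ?_
    have hself : v ∈ S ∧ net.boxClass P v = net.boxClass P v ∧
        h j (net.id v) = h j (net.id v) := ⟨hBS v hv, rfl, rfl⟩
    rw [heard_eq_of_hears (v := v), if_pos hself]
    have hT : ∀ w, w ∈ {w | (if w ∈ S ∧ net.boxClass P w = net.boxClass P v ∧
        h j (net.id w) = h j (net.id v) then some (enc (net.id w)) else none).isSome} ↔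
        w ∈ S ∧ net.boxClass P w = net.boxClass P v ∧ h j (net.id w) = h j (net.id v) := by
      intro w
      simp only [Set.mem_ofPred_eq]
      split_ifs with hc <;> simp [hc]
    refine hears_of_sum_le ((hT v).2 hself) (fun hmem => ?_) (adj_of_box_eq huv hu)
      ({w ∈ W | h j (net.id w) = h j (net.id v)}) (fun w hw hne => ?_) ?_
    · have hmem := (hT u).1 hmem
      exact hiso u (mem_filter.2 ⟨mem_univ _, hmem.1, hu.trans hvb⟩) huv hmem.2.2
    · have hw := (hT w).1 hw
      refine mem_filter.2 ⟨mem_filter.2 ⟨mem_univ _, hw.1, ?_, fun e => ?_⟩, hw.2.2⟩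
      · rw [hw.2.1, ← hvb]
        rfl
      · exact hiso w (mem_filter.2 ⟨mem_univ _, hw.1, e⟩) hne hw.2.2
    · refine le_trans (sum_le_sum fun w hw => ?_) (hle.trans (by rw [hη]; linarith))
      simp only [hW, mem_filter, mem_univ, true_and] at hw
      have hc : net.boxClass P v = net.boxClass P w := by
        rw [hw.1.2.1, ← hvb]
        rfl
      have := signal_le_weight (u := u) (v := v) (w := w) (fun i => by rw [hu]; simp) hc
        (by rw [hvb]; exact fun e => hw.1.2.2 e.symm)
      rwa [hvb] at this
  -- Isolated stations have distinct hash values, so their interferers are disjoint parts of `W`,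
  -- whose total weight is at most `k * η`.
  have hI : ∀ j, 8 * #{v ∈ B | iso j v} ≤ k := by
    intro j
    have hinj : Set.InjOn (fun v => h j (net.id v)) ({v ∈ B | iso j v} : Finset V) := by
      intro v hv v' hv' he
      by_contra hne
      exact (mem_filter.1 hv).2 v' (hBSb (mem_filter.1 hv').1) (fun e => hne e.symm) he.symm
    have h1 : (#{v ∈ B | iso j v} : ℝ) * (8 * η) ≤ k * η := by
      calc _ = ∑ v ∈ B with iso j v, 8 * η := by rw [sum_const, nsmul_eq_mul]
        _ ≤ ∑ v ∈ B with iso j v, ∑ w ∈ W with h j (net.id w) = h j (net.id v), wt w :=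
            sum_le_sum fun v hv => (hX j v (mem_filter.1 hv).1 (mem_filter.1 hv).2).le
        _ = ∑ a ∈ ({v ∈ B | iso j v} : Finset V).image (fun v => h j (net.id v)),
              ∑ w ∈ W with h j (net.id w) = a, wt w :=
            (sum_image (f := fun a => ∑ w ∈ W with h j (net.id w) = a, wt w) hinj).symm
        _ ≤ ∑ a, ∑ w ∈ W with h j (net.id w) = a, wt w :=
            sum_le_sum_of_subset_of_nonneg (subset_univ _) fun a _ _ =>
              sum_nonneg fun w _ => hwt w
        _ = ∑ w ∈ W, wt w := sum_fiberwise _ _ _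
        _ ≤ k * η := hWsum
    have h2 : (8 * #{v ∈ B | iso j v} : ℝ) ≤ k := by nlinarith
    exact_mod_cast h2
  have hids := hh (Sb.image net.id) (card_image_le.trans (hS b))
  -- The other stations of `B` collide inside the box. Averaged over `j`, each of the two kinds
  -- contributes at most `k / 8`.
  have hsplit : ∀ j, #B ≤ #{v ∈ B | iso j v} +
      #{x ∈ Sb.image net.id | ∃ w ∈ Sb.image net.id, w ≠ x ∧ h j w = h j x} := by
    intro j
    rw [← card_filter_add_card_filter_not (s := B) (iso j)]
    refine Nat.add_le_add_left (card_le_card_of_injOn net.id ?_ net.id_injective.injOn) _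
    intro v hv
    obtain ⟨hv, hni⟩ := mem_filter.1 hv
    simp only [iso, not_forall, not_not] at hni
    obtain ⟨w, hw, hne, he⟩ := hni
    exact mem_filter.2 ⟨mem_image_of_mem _ (hBSb hv), net.id w, mem_image_of_mem _ hw,
      fun e => hne (net.id_injective e), he⟩
  have hsum : L * #B ≤ ∑ j, #{v ∈ B | iso j v} +
      ∑ j, #{x ∈ Sb.image net.id | ∃ w ∈ Sb.image net.id, w ≠ x ∧ h j w = h j x} := by
    rw [← sum_add_distrib]
    calc L * #B = ∑ _j : Fin L, #B := by simp
      _ ≤ _ := sum_le_sum fun j _ => hsplit j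
  have hIsum : 8 * ∑ j, #{v ∈ B | iso j v} ≤ L * k := by
    rw [mul_sum]
    calc _ ≤ ∑ _j : Fin L, k := sum_le_sum fun j _ => hI j
      _ = L * k := by simp
  have hids' : 8 * ∑ j, #{x ∈ Sb.image net.id | ∃ w ∈ Sb.image net.id, w ≠ x ∧ h j w = h j x} ≤
      L * k := by
    convert hids
  have : L * (4 * #B) ≤ L * k := by nlinarith
  exact Nat.le_of_mul_le_mul_left this hL

end Network

/-! ### Protocols for electing leaders and enrolling the boxes -/

/-- A short family of hash functions with few collisions on each set of at most `k` identifiers. -/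
structure HashFamily (N k q : ℕ) where
  fn : Fin (Nat.log 2 N + 1) → Fin N → Fin q
  few_collisions : ∀ S : Finset (Fin N), S.card ≤ k →
    8 * ∑ j, (S.filter fun v => ∃ w ∈ S, w ≠ v ∧ fn j w = fn j v).card ≤ (Nat.log 2 N + 1) * k

/-- The rounds in which each class of boxes uses a family of hash functions. -/
abbrev HashKey (P : SINRParams) (N q : ℕ) : Type :=
  P.BoxClass × Fin (Nat.log 2 N + 1) × Fin q

/-- The number of stations of `A` in each box is at most `k`. -/
def Network.BoxBounded {N : ℕ} {V : Type} (P : SINRParams) (net : Network N V)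
    (A : Set V) (k : ℕ) : Prop :=
  ∀ b, {v | v ∈ A ∧ net.box P v = b}.ncard ≤ k

/-- Run the stages `m - 1`, ..., `0`. -/
def runStages {X : Type*} (stage : ℕ → X → X) : ℕ → X → X
  | 0, x => x
  | m + 1, x => runStages stage m (stage m x)

/-- The stage costs form a geometric series, so the number of stages does not enter as a factor. -/
theorem rounds_runStages_le {I M O : Type} {stage : ℕ → Protocol I M O → Protocol I M O} {a : ℕ}
    (h : ∀ i π, (stage i π).rounds ≤ π.rounds + a * 2 ^ i) (m : ℕ) (π : Protocol I M O) :
    (runStages stage m π).rounds ≤ π.rounds + a * 2 ^ m := by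
  induction m generalizing π with
  | zero => simp [runStages]
  | succ m ih =>
    refine (ih _).trans ((Nat.add_le_add_right (h m π) _).trans ?_)
    rw [pow_succ]
    linarith

/-- A station during the election of the leaders of the boxes. -/
structure Candidate (N : ℕ) where
  id : Fin N
  pos : Plane
  active : Prop

/-- A station that knows its leader, and some of the stations of its box. -/
structure Member (N : ℕ) where
  id : Fin N
  pos : Plane
  leader : Fin N
  roster : Set (Fin N)

section Construction

variable {P : SINRParams} {N : ℕ} {I M : Type}

open Classical in
/-- The active stations transmit by a hash family; a station that hears a smaller identifier
from its box becomes inactive. -/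
noncomputable def electStage (P : SINRParams) (enc : Fin N → M) {k q : ℕ} (F : HashFamily N k q)
    (π : Protocol I M (Candidate N)) : Protocol I M (Candidate N) :=
  π.andThen (K := HashKey P N q)
    (fun a κ => if a.active ∧ P.classOf (P.box a.pos) = κ.1 ∧ F.fn κ.2.1 a.id = κ.2.2 then
      some (enc a.id) else none)
    (fun a tbl => ⟨a.id, a.pos, a.active ∧
      ∀ j x y, y < a.id → tbl (P.classOf (P.box a.pos), j, x) ≠ some (enc y)⟩)

open Classical in
/-- The remaining active stations announce that they are the leaders of their boxes. -/
noncomputable def announceLeaders (P : SINRParams) (enc : Fin N → M)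
    (π : Protocol I M (Candidate N)) : Protocol I M (Member N) :=
  π.andThen (K := P.BoxClass)
    (fun a c => if a.active ∧ P.classOf (P.box a.pos) = c then some (enc a.id) else none)
    (fun a tbl =>
      let l := if h : ∃ i, tbl (P.classOf (P.box a.pos)) = some (enc i) then h.choose else a.id
      ⟨a.id, a.pos, l, {l}⟩)

open Classical in
/-- The stations that are not on the roster transmit by a hash family, and the leader repeats
what it hears, so that all stations of the box can extend the roster. -/
noncomputable def enrollStage (P : SINRParams) (enc : Fin N → M) {k q : ℕ} (F : HashFamily N k q)
    (π : Protocol I M (Member N)) : Protocol I M (Member N) :=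
  (π.andThen (K := HashKey P N q)
    (fun a κ => if a.id ∉ a.roster ∧ P.classOf (P.box a.pos) = κ.1 ∧ F.fn κ.2.1 a.id = κ.2.2 then
      some (enc a.id) else none)
    (fun a tbl => (a, tbl))).andThen (K := HashKey P N q)
      (fun a κ => if a.1.id = a.1.leader ∧ P.classOf (P.box a.1.pos) = κ.1 then a.2 κ else none)
      (fun a tbl => ⟨a.1.id, a.1.pos, a.1.leader, a.1.roster ∪ {i | ∃ j x,
        (if a.1.id = a.1.leader then a.2 else tbl) (P.classOf (P.box a.1.pos), j, x) =
          some (enc i)}⟩)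

end Construction

/-! ### Correctness of election and enrollment -/

namespace Network

variable {P : SINRParams} {N : ℕ} {V : Type}

/-- Each box has at most `k` active stations, and at least one if it is not empty. -/
structure IsCandidacy (P : SINRParams) (net : Network N V) (k : ℕ) (st : V → Candidate N) :
    Prop where
  id_eq : ∀ v, (st v).id = net.id v
  pos_eq : ∀ v, (st v).pos = net.pos v
  bounded : net.BoxBounded P {v | (st v).active} k
  exists_active : ∀ v, ∃ u, net.box P u = net.box P v ∧ (st u).active

/-- `lead` selects a station in each box. -/
structure IsLeaderMap (P : SINRParams) (net : Network N V) (lead : V → V) : Prop where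
  box_lead : ∀ v, net.box P (lead v) = net.box P v
  lead_eq : ∀ u v, net.box P u = net.box P v → lead u = lead v

theorem IsLeaderMap.lead_lead {net : Network N V} {lead : V → V} (h : net.IsLeaderMap P lead)
    (v : V) : lead (lead v) = lead v :=
  h.lead_eq _ _ (h.box_lead v)

/-- The stations of each box have the same leader and the same roster, on which at most `k`
stations of the box are missing. -/
structure IsEnrollment (P : SINRParams) (net : Network N V) (lead : V → V) (k : ℕ)
    (st : V → Member N) : Prop where
  id_eq : ∀ v, (st v).id = net.id v
  pos_eq : ∀ v, (st v).pos = net.pos v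
  leader_eq : ∀ v, (st v).leader = net.id (lead v)
  roster_congr : ∀ u v, net.box P u = net.box P v → (st u).roster = (st v).roster
  exists_of_mem : ∀ v, ∀ i ∈ (st v).roster, ∃ u, net.box P u = net.box P v ∧ net.id u = i
  leader_mem : ∀ v, net.id (lead v) ∈ (st v).roster
  bounded : net.BoxBounded P {v | net.id v ∉ (st v).roster} k

variable {net : Network N V} {I M : Type} {enc : Fin N → M} {input : V → I}

theorem BoxBounded.mono {A : Set V} {k k' : ℕ} (h : net.BoxBounded P A k) (hk : k ≤ k') :
    net.BoxBounded P A k' := fun b => (h b).trans hk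

variable [Fintype V]

/-- The survivor of largest identifier in a box heard none of the other survivors, whose identifiers
are smaller; so at most `k / 4` of those exist, and the `+ 1` is that survivor itself. The active
station of smallest identifier is never silenced, since in the rounds of its class it hears only its
own box. -/
theorem isCandidacy_electStage (henc : Function.Injective enc) {k q : ℕ} (F : HashFamily N k q)
    {π : Protocol I M (Candidate N)} (h : net.IsCandidacy P k (π.run P net input)) :
    net.IsCandidacy P (k / 4 + 1) ((electStage P enc F π).run P net input) := by
  classical
  set st := π.run P net input with hst
  have hcls : ∀ v, P.classOf (P.box (st v).pos) = net.boxClass P v := fun v => by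
    rw [h.pos_eq]; rfl
  let msg : V → HashKey P N q → Option M := fun v κ =>
    if (st v).active ∧ net.boxClass P v = κ.1 ∧ F.fn κ.2.1 (net.id v) = κ.2.2 then
      some (enc (net.id v)) else none
  have hrun : ∀ v, (electStage P enc F π).run P net input v = ⟨net.id v, net.pos v,
      (st v).active ∧ ∀ j x y, y < net.id v →
        net.heard P (fun w => msg w (net.boxClass P v, j, x)) v ≠ some (enc y)⟩ := by
    intro v
    rw [electStage, Protocol.run_andThen]
    simp only [← hst, h.id_eq, hcls, msg]
    rw [h.pos_eq]
  have hheard : ∀ v j x y, net.heard P (fun w => msg w (net.boxClass P v, j, x)) v =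
      some (enc y) → ∃ u, net.box P u = net.box P v ∧ (st u).active ∧ net.id u = y := by
    intro v j x y hy
    obtain ⟨u, hadj, hu⟩ := exists_adj_of_heard_eq_some hy
    simp only [msg] at hu
    split_ifs at hu with hc
    refine ⟨u, (box_eq_of_adj hadj hc.2.1.symm).symm, hc.1, henc (Option.some_injective _ hu)⟩
  refine ⟨fun v => by rw [hrun], fun v => by rw [hrun], fun b => ?_, fun v => ?_⟩
  · set E : Set V := {v | v ∈ {v | ((electStage P enc F π).run P net input v).active} ∧
      net.box P v = b} with hE
    have hEmem : ∀ v ∈ E, (st v).active ∧ net.box P v = b ∧ ∀ j x y, y < net.id v →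
        net.heard P (fun w => msg w (net.boxClass P v, j, x)) v ≠ some (enc y) := by
      intro v hv
      obtain ⟨hv, hb⟩ := hv
      simp only [Set.mem_ofPred_eq, hrun] at hv
      exact ⟨hv.1, hb, hv.2⟩
    rcases E.eq_empty_or_nonempty with h0 | hne
    · rw [h0]; simp
    obtain ⟨m, hm, hmax⟩ := Set.exists_max_image E net.id E.toFinite hne
    have hB := four_mul_card_unheard_le (P := P) (net := net) (M := M) (Nat.succ_pos _) F.fn
      F.few_collisions {v | (st v).active} (fun b => by
        have := h.bounded b
        rw [Set.ncard_eq_toFinset_card'] at this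
        convert this using 2
        ext; simp) enc b (E \ {m}).toFinset
      (fun v hv => (hEmem v (by simp at hv; exact hv.1)).1)
      (fun v hv => (hEmem v (by simp at hv; exact hv.1)).2.1)
      (fun v hv j => by
        have hv : v ∈ E ∧ v ≠ m := by simpa using hv
        have hbox : net.box P m = net.box P v :=
          (hEmem m hm).2.1.trans (hEmem v hv.1).2.1.symm
        refine ⟨m, hbox, fun e => hv.2 e.symm, ?_⟩
        have hlt : net.id v < net.id m :=
          lt_of_le_of_ne (hmax v hv.1) fun e => hv.2 (net.id_injective e)
        have hcl : net.boxClass P m = net.boxClass P v := by rw [boxClass, boxClass, hbox]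
        have := (hEmem m hm).2.2 j (F.fn j (net.id v)) (net.id v) hlt
        rw [hcl] at this
        exact this)
    rw [← Set.ncard_eq_toFinset_card'] at hB
    have := Set.ncard_sdiff_singleton_add_one hm E.toFinite
    omega
  · obtain ⟨m, hm, hmin⟩ := Set.exists_min_image {u | net.box P u = net.box P v ∧ (st u).active}
      net.id (Set.toFinite _) (h.exists_active v)
    refine ⟨m, hm.1, ?_⟩
    rw [hrun]
    refine ⟨hm.2, fun j x y hy he => ?_⟩
    obtain ⟨u, hub, hua, rfl⟩ := hheard m j x y he
    exact absurd (hmin u ⟨hub.trans hm.1, hua⟩) (not_le.2 hy)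

/-- A stage turns `2 ^ (m + 1)` into `2 ^ (m + 1) / 4 + 1 ≤ 2 ^ m`, and the last one gives `1 / 4 +
1 = 1`. -/
theorem isCandidacy_runStages (henc : Function.Injective enc) {q : ℕ → ℕ}
    (F : ∀ i, HashFamily N (2 ^ i) (q i)) {m : ℕ} {π : Protocol I M (Candidate N)}
    (h : net.IsCandidacy P (2 ^ m) (π.run P net input)) :
    net.IsCandidacy P 1
      ((runStages (fun i => electStage P enc (F i)) (m + 1) π).run P net input) := by
  induction m generalizing π with
  | zero => exact isCandidacy_electStage henc (F 0) h
  | succ m ih =>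
    rw [runStages]
    have h' := isCandidacy_electStage henc (F (m + 1)) h
    refine ih ⟨h'.id_eq, h'.pos_eq, h'.bounded.mono ?_, h'.exists_active⟩
    have := Nat.one_le_two_pow (n := m)
    rw [pow_succ]
    omega

/-- With one active station per box there are no collisions. The leader itself hears nothing in the
round of its class and falls back on its own identifier. -/
theorem exists_isEnrollment_announceLeaders (henc : Function.Injective enc) {k : ℕ}
    {π : Protocol I M (Candidate N)} (h : net.IsCandidacy P 1 (π.run P net input))
    (hk : net.BoxBounded P Set.univ k) :
    ∃ lead, net.IsLeaderMap P lead ∧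
      net.IsEnrollment P lead k ((announceLeaders P enc π).run P net input) := by
  classical
  set st := π.run P net input with hst
  have hcls : ∀ v, P.classOf (P.box (st v).pos) = net.boxClass P v := fun v => by
    rw [h.pos_eq]; rfl
  have huniq : ∀ u v, net.box P u = net.box P v → (st u).active → (st v).active → u = v := by
    intro u v hb hu hv
    exact (Set.ncard_le_one (Set.toFinite _)).1 (h.bounded (net.box P v)) u ⟨hu, hb⟩ v ⟨hv, rfl⟩
  choose lead hlead using h.exists_active
  have hmap : net.IsLeaderMap P lead := ⟨fun v => (hlead v).1, fun u v hb =>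
    huniq _ _ ((hlead u).1.trans (hb.trans (hlead v).1.symm)) (hlead u).2 (hlead v).2⟩
  let msg : V → P.BoxClass → Option M := fun v c =>
    if (st v).active ∧ net.boxClass P v = c then some (enc (net.id v)) else none
  have hheard : ∀ v i, net.heard P (fun w => msg w (net.boxClass P v)) v = some (enc i) ↔
      v ≠ lead v ∧ net.id (lead v) = i := by
    intro v i
    rw [heard_eq_some_iff (c := net.boxClass P v)
      (by intro w x hw; simp only [msg] at hw; split_ifs at hw with hc; exact hc.2)
      (by
        intro w w' x y hw hw' hb
        simp only [msg] at hw hw'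
        split_ifs at hw hw' with hc hc'
        exact huniq w w' hb hc.1 hc'.1)]
    constructor
    · rintro ⟨w, hadj, hw⟩
      simp only [msg] at hw
      split_ifs at hw with hc
      have hwl : w = lead v :=
        huniq _ _ ((box_eq_of_adj hadj hc.2.symm).symm.trans (hlead v).1.symm) hc.1 (hlead v).2
      exact ⟨hwl ▸ hadj.1, hwl ▸ henc (Option.some_injective _ hw)⟩
    · rintro ⟨hne, rfl⟩
      refine ⟨lead v, adj_of_box_eq hne (hlead v).1.symm, ?_⟩
      simp only [msg]
      rw [if_pos ⟨(hlead v).2, by rw [boxClass, boxClass, (hlead v).1]⟩]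
  have hrun : ∀ v, (announceLeaders P enc π).run P net input v =
      ⟨net.id v, net.pos v, net.id (lead v), {net.id (lead v)}⟩ := by
    intro v
    rw [announceLeaders, Protocol.run_andThen]
    simp only [← hst, h.id_eq, hcls]
    have hl : (if h : ∃ i, net.heard P (fun w => msg w (net.boxClass P v)) v = some (enc i) then
        h.choose else net.id v) = net.id (lead v) := by
      split_ifs with hex
      · exact ((hheard v _).1 hex.choose_spec).2.symm
      · by_contra hne
        exact hex ⟨net.id (lead v), (hheard v _).2 ⟨fun e => hne (congrArg net.id e), rfl⟩⟩
    simp only [msg] at hl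
    simp only [hl, h.pos_eq]
  refine ⟨lead, hmap, fun v => by rw [hrun], fun v => by rw [hrun], fun v => by rw [hrun],
    fun u v hb => by rw [hrun, hrun, hmap.lead_eq u v hb], fun v i hi => ?_,
    fun v => by rw [hrun]; rfl, fun b => ?_⟩
  · rw [hrun] at hi
    exact ⟨lead v, (hlead v).1, hi.symm⟩
  · exact (Set.ncard_le_ncard (Set.ofPred_subset_ofPred.2 fun v hv => ⟨trivial, hv.2⟩)
      (Set.toFinite _)).trans (hk b)

/-- The leader is on the roster and therefore listens, so all but `k / 4` missing stations reach it.
In the echo only leaders transmit, so the whole box obtains the leader's table and the rosters stay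
equal. -/
theorem isEnrollment_enrollStage (henc : Function.Injective enc) {lead : V → V}
    (hl : net.IsLeaderMap P lead) {k q : ℕ} (F : HashFamily N k q)
    {π : Protocol I M (Member N)} (h : net.IsEnrollment P lead k (π.run P net input)) :
    net.IsEnrollment P lead (k / 4) ((enrollStage P enc F π).run P net input) := by
  classical
  set st := π.run P net input with hst
  have hcls : ∀ v, P.classOf (P.box (st v).pos) = net.boxClass P v := fun v => by
    rw [h.pos_eq]; rfl
  have hid : ∀ v, net.id v = net.id (lead v) ↔ v = lead v := fun v => net.id_injective.eq_iff
  let msg : V → HashKey P N q → Option M := fun v κ =>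
    if net.id v ∉ (st v).roster ∧ net.boxClass P v = κ.1 ∧ F.fn κ.2.1 (net.id v) = κ.2.2 then
      some (enc (net.id v)) else none
  let tbl : V → HashKey P N q → Option M := fun v κ => net.heard P (fun w => msg w κ) v
  let msg' : V → HashKey P N q → Option M := fun v κ =>
    if v = lead v ∧ net.boxClass P v = κ.1 then tbl v κ else none
  have hrun : ∀ v, (enrollStage P enc F π).run P net input v =
      ⟨net.id v, net.pos v, net.id (lead v), (st v).roster ∪ {i | ∃ j x,
        (if v = lead v then tbl v else fun κ => net.heard P (fun w => msg' w κ) v)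
          (net.boxClass P v, j, x) = some (enc i)}⟩ := by
    intro v
    rw [enrollStage, Protocol.run_andThen]
    simp only [Protocol.run_andThen, ← hst, h.id_eq, hcls, h.leader_eq, hid, msg', tbl, msg]
    rw [h.pos_eq]
  have hclead : ∀ v, net.boxClass P (lead v) = net.boxClass P v := fun v => by
    rw [boxClass, boxClass, hl.box_lead]
  have htbl : ∀ v j x i, (if v = lead v then tbl v else
      fun κ => net.heard P (fun w => msg' w κ) v) (net.boxClass P v, j, x) = some (enc i) ↔
      tbl (lead v) (net.boxClass P v, j, x) = some (enc i) := by
    intro v j x i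
    split_ifs with hv
    · rw [← hv]
    rw [heard_eq_some_iff (c := net.boxClass P v)
      (by intro w x hw; simp only [msg'] at hw; split_ifs at hw with hc; exact hc.2)
      (by
        intro w w' x y hw hw' hb
        simp only [msg'] at hw hw'
        split_ifs at hw hw' with hc hc'
        rw [hc.1, hc'.1]
        exact hl.lead_eq _ _ hb)]
    constructor
    · rintro ⟨w, hadj, hw⟩
      simp only [msg'] at hw
      split_ifs at hw with hc
      have hwl : w = lead v := by
        rw [hc.1]
        exact (hl.lead_eq _ _ (box_eq_of_adj hadj hc.2.symm)).symm
      rwa [← hwl]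
    · intro hx
      refine ⟨lead v, adj_of_box_eq hv (hl.box_lead v).symm, ?_⟩
      simp only [msg']
      rwa [if_pos ⟨(hl.lead_lead v).symm, hclead v⟩]
  have hroster : ∀ v, ((enrollStage P enc F π).run P net input v).roster =
      (st v).roster ∪ {i | ∃ j x, tbl (lead v) (net.boxClass P v, j, x) = some (enc i)} := by
    intro v
    rw [hrun]
    simp only [htbl]
  refine ⟨fun v => by rw [hrun], fun v => by rw [hrun], fun v => by rw [hrun], fun u v hb => ?_,
    fun v i hi => ?_, fun v => by rw [hroster]; exact Or.inl (h.leader_mem v), fun b => ?_⟩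
  · rw [hroster, hroster, h.roster_congr u v hb, hl.lead_eq u v hb, boxClass, boxClass, hb]
  · rw [hroster] at hi
    rcases hi with hi | ⟨j, x, hx⟩
    · exact h.exists_of_mem v i hi
    · obtain ⟨u, hadj, hu⟩ := exists_adj_of_heard_eq_some hx
      simp only [msg] at hu
      split_ifs at hu with hc
      refine ⟨u, ?_, henc (Option.some_injective _ hu)⟩
      rw [← hl.box_lead v]
      exact (box_eq_of_adj hadj ((hclead v).trans hc.2.1.symm)).symm
  · set E : Set V := {v | v ∈ {v | net.id v ∉ ((enrollStage P enc F π).run P net input v).roster} ∧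
      net.box P v = b} with hE
    have hEmem : ∀ v ∈ E, net.id v ∉ (st v).roster ∧ net.box P v = b ∧
        ∀ j x, tbl (lead v) (net.boxClass P v, j, x) ≠ some (enc (net.id v)) := by
      intro v hv
      obtain ⟨hv, hb⟩ := hv
      rw [Set.mem_ofPred_eq, hroster] at hv
      exact ⟨fun h1 => hv (Or.inl h1), hb, fun j x h1 => hv (Or.inr ⟨j, x, h1⟩)⟩
    have hB := four_mul_card_unheard_le (P := P) (net := net) (M := M) (Nat.succ_pos _) F.fn
      F.few_collisions {v | net.id v ∉ (st v).roster} (fun b => by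
        have := h.bounded b
        rw [Set.ncard_eq_toFinset_card'] at this
        convert this using 2
        ext; simp) enc b E.toFinset
      (fun v hv => (hEmem v (by simpa using hv)).1)
      (fun v hv => (hEmem v (by simpa using hv)).2.1)
      (fun v hv j => by
        have hv : v ∈ E := by simpa using hv
        refine ⟨lead v, hl.box_lead v, fun e => ?_, fun he =>
          (hEmem v hv).2.2 j (F.fn j (net.id v)) ?_⟩
        · have := h.leader_mem v
          rw [e] at this
          exact (hEmem v hv).1 this
        · convert he)
    rw [← Set.ncard_eq_toFinset_card'] at hB
    omega

/-- Unlike in the election no `+ 1` remains: `1 / 4 = 0`, so nobody is missing at the end. -/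
theorem isEnrollment_runStages (henc : Function.Injective enc) {lead : V → V}
    (hl : net.IsLeaderMap P lead) {q : ℕ → ℕ} (F : ∀ i, HashFamily N (2 ^ i) (q i)) {m : ℕ}
    {π : Protocol I M (Member N)} (h : net.IsEnrollment P lead (2 ^ m) (π.run P net input)) :
    net.IsEnrollment P lead 0
      ((runStages (fun i => enrollStage P enc (F i)) (m + 1) π).run P net input) := by
  induction m generalizing π with
  | zero => exact isEnrollment_enrollStage henc hl (F 0) h
  | succ m ih =>
    rw [runStages]
    have h' := isEnrollment_enrollStage henc hl (F (m + 1)) h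
    refine ih ⟨h'.id_eq, h'.pos_eq, h'.leader_eq, h'.roster_congr, h'.exists_of_mem, h'.leader_mem,
      h'.bounded.mono ?_⟩
    rw [pow_succ]
    omega

end Network

/-! ### Slots, gateways and contacts -/

open Classical in
/-- Slots for the identifiers in `R`. -/
noncomputable def slotOf {N : ℕ} (n : ℕ) (R : Set (Fin N)) : Fin N → Fin (n + 1) :=
  if h : ∃ f : Fin N → Fin (n + 1), Set.InjOn f R then h.choose else fun _ => 0

/-- The slots are chosen from the set alone, so stations with equal rosters agree on them without
communication. -/
theorem injOn_slotOf {N n : ℕ} {R : Set (Fin N)} (h : R.ncard ≤ n + 1) :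
    Set.InjOn (slotOf n R) R := by
  have hex : ∃ f : Fin N → Fin (n + 1), Set.InjOn f R := by
    classical
    obtain ⟨e⟩ := Function.Embedding.nonempty_of_card_le (α := R) (β := Fin (n + 1))
      (by rwa [← Nat.card_coe_set_eq, Nat.card_eq_fintype_card,
        ← Fintype.card_fin (n + 1)] at h)
    refine ⟨fun i => if hi : i ∈ R then e ⟨i, hi⟩ else 0, fun i hi j hj he => ?_⟩
    simp only [dif_pos hi, dif_pos hj] at he
    exact congrArg Subtype.val (e.injective he)
  rw [slotOf, dif_pos hex]
  exact hex.choose_spec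

/-- The roles of the backbone stations of a box: leader, gateway to the neighbouring box of some
class, or contact of the gateway in the neighbouring box of some class. -/
abbrev Role (P : SINRParams) : Type := Option (P.BoxClass ⊕ P.BoxClass)

/-- A station that knows its leader, its slot in its box, and its neighbours in the boxes of each
class. -/
structure Scout (P : SINRParams) (N Δ : ℕ) where
  id : Fin N
  boxClass : P.BoxClass
  leader : Fin N
  slot : Fin (Δ + 1)
  reach : P.BoxClass → Set (Fin N)

/-- What a station remembers of the construction: in `contact`, the roles of its neighbours. -/
structure StationMemory (P : SINRParams) (N Δ : ℕ) where
  id : Fin N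
  boxClass : P.BoxClass
  slot : Fin (Δ + 1)
  role : Role P → Prop
  contact : P.BoxClass → Role P → Fin N → Prop

section Construction

variable {P : SINRParams} {N Δ : ℕ} {I M : Type}

open Classical in
/-- The stations of a box transmit their identifiers one by one. -/
noncomputable def scoutNeighbours (P : SINRParams) (Δ : ℕ) (enc : Fin N → M)
    (π : Protocol I M (Member N)) : Protocol I M (Scout P N Δ) :=
  π.andThen (K := P.BoxClass × Fin (Δ + 1))
    (fun a κ => if P.classOf (P.box a.pos) = κ.1 ∧ slotOf Δ a.roster a.id = κ.2 then
      some (enc a.id) else none)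
    (fun a tbl => ⟨a.id, P.classOf (P.box a.pos), a.leader, slotOf Δ a.roster a.id,
      fun c => {i | ∃ s, tbl (c, s) = some (enc i)}⟩)

open Classical in
/-- For each class, the stations of a box that have a neighbour in this class announce themselves.
The one with the smallest identifier becomes a gateway. -/
noncomputable def chooseGateways (enc : Fin N → M) (π : Protocol I M (Scout P N Δ)) :
    Protocol I M (Scout P N Δ × (P.BoxClass → Prop)) :=
  π.andThen (K := P.BoxClass × Fin (Δ + 1) × P.BoxClass)
    (fun a κ => if a.boxClass = κ.1 ∧ a.slot = κ.2.1 ∧ (a.reach κ.2.2).Nonempty then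
      some (enc a.id) else none)
    (fun a tbl => (a, fun c => (a.reach c).Nonempty ∧
      ∀ s y, tbl (a.boxClass, s, c) = some (enc y) → a.id ≤ y))

open Classical in
/-- Each gateway picks a neighbour in the neighbouring box and informs it. -/
noncomputable def informContacts (enc : Fin N → M)
    (π : Protocol I M (Scout P N Δ × (P.BoxClass → Prop))) :
    Protocol I M (Scout P N Δ × (Role P → Prop)) :=
  π.andThen (K := P.BoxClass × P.BoxClass)
    (fun a κ => if h : a.1.boxClass = κ.1 ∧ a.2 κ.2 ∧ (a.1.reach κ.2).Nonempty then
      some (enc h.2.2.some) else none)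
    (fun a tbl => (a.1, fun ρ => match ρ with
      | none => a.1.id = a.1.leader
      | some (.inl c) => a.2 c
      | some (.inr c) => tbl (c, a.1.boxClass) = some (enc a.1.id)))

open Classical in
/-- The holders of roles introduce themselves to their neighbours. -/
noncomputable def exchangeContacts (enc : Fin N → M)
    (π : Protocol I M (Scout P N Δ × (Role P → Prop))) :
    Protocol I M (BackboneRecord N (StationMemory P N Δ)) :=
  π.andThen (K := P.BoxClass × Role P)
    (fun a κ => if a.1.boxClass = κ.1 ∧ a.2 κ.2 then some (enc a.1.id) else none)
    (fun a tbl => ⟨decide (∃ ρ, a.2 ρ), a.1.leader, ⟨a.1.id, a.1.boxClass, a.1.slot, a.2,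
      fun c ρ i => tbl (c, ρ) = some (enc i)⟩⟩)

end Construction

namespace Network

variable {P : SINRParams} {N Δ : ℕ} {V : Type}

/-- The outcome of the construction: leaders, slots and roles, such that the roles connect the
boxes. -/
structure IsLayout (P : SINRParams) (net : Network N V) (lead : V → V) (slot : V → Fin (Δ + 1))
    (role : V → Role P → Prop) : Prop extends net.IsLeaderMap P lead where
  slot_inj : ∀ u v, net.box P u = net.box P v → slot u = slot v → u = v
  role_unique : ∀ u v ρ, net.box P u = net.box P v → role u ρ → role v ρ → u = v
  role_none_iff : ∀ v, role v none ↔ v = lead v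
  exists_bridge : ∀ u v, (net.graph P).Adj u v → net.box P u ≠ net.box P v →
    ∃ x y, net.box P x = net.box P u ∧ net.box P y = net.box P v ∧ (net.graph P).Adj x y ∧
      (∃ ρ, role x ρ) ∧ ∃ ρ, role y ρ

open Classical in
/-- The record of a station in a layout. -/
noncomputable def layoutRecord (P : SINRParams) (net : Network N V) (lead : V → V)
    (slot : V → Fin (Δ + 1)) (role : V → Role P → Prop) (v : V) :
    BackboneRecord N (StationMemory P N Δ) :=
  ⟨decide (∃ ρ, role v ρ), net.id (lead v), ⟨net.id v, net.boxClass P v, slot v, role v,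
    fun c ρ i => ∃ u, (net.graph P).Adj v u ∧ net.boxClass P u = c ∧ role u ρ ∧ net.id u = i⟩⟩

/-- The record of a station that knows its neighbours. -/
noncomputable def scoutRecord (P : SINRParams) (net : Network N V) (lead : V → V) (slot : V → Fin (Δ + 1))
    (v : V) : Scout P N Δ :=
  ⟨net.id v, net.boxClass P v, net.id (lead v), slot v, fun c =>
    {i | ∃ u, (net.graph P).Adj v u ∧ net.boxClass P u = c ∧ net.id u = i}⟩

/-- `v` is the gateway of its box to the neighbouring box of class `c`. -/
def IsGateway (P : SINRParams) (net : Network N V) (v : V) (c : P.BoxClass) : Prop :=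
  (∃ w, (net.graph P).Adj v w ∧ net.boxClass P w = c) ∧ ∀ u, net.box P u = net.box P v →
    (∃ w, (net.graph P).Adj u w ∧ net.boxClass P w = c) → net.id v ≤ net.id u

variable {net : Network N V} {I M : Type} {enc : Fin N → M} {input : V → I}

/-- This lets a class name stand for a box: all neighbours of one box that lie in one class lie in
one box. -/
theorem box_eq_of_adj_of_adj {u u' v w : V} (hb : net.box P u = net.box P u')
    (hv : (net.graph P).Adj u v) (hw : (net.graph P).Adj u' w)
    (h : net.boxClass P v = net.boxClass P w) : net.box P v = net.box P w := by
  refine SINRParams.eq_of_classOf_eq h fun i => ?_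
  have h1 := abs_le.1 (abs_box_sub_le_two hv i)
  have h2 := abs_le.1 (abs_box_sub_le_two hw i)
  rw [← hb] at h2
  rw [abs_le]
  constructor <;> linarith [h1.1, h1.2, h2.1, h2.2]

theorem boxClass_congr {u v : V} (h : net.box P u = net.box P v) :
    net.boxClass P u = net.boxClass P v := congrArg P.classOf h

theorem IsGateway.unique {u v : V} {c : P.BoxClass} (hb : net.box P u = net.box P v)
    (hu : net.IsGateway P u c) (hv : net.IsGateway P v c) : u = v :=
  net.id_injective (le_antisymm (hu.2 v hb.symm hv.1) (hv.2 u hb hu.1))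

variable [Fintype V]

/-- With nobody missing, the common roster is the whole box; its slots leave one transmitter per box
in each round, so every neighbour is heard. -/
theorem exists_run_scoutNeighbours (henc : Function.Injective enc) {lead : V → V}
    {π : Protocol I M (Member N)} (h : net.IsEnrollment P lead 0 (π.run P net input))
    (hΔ : net.BoxBounded P Set.univ (Δ + 1)) :
    ∃ slot : V → Fin (Δ + 1), (∀ u v, net.box P u = net.box P v → slot u = slot v → u = v) ∧
      (scoutNeighbours P Δ enc π).run P net input = net.scoutRecord P lead slot := by
  classical
  set st := π.run P net input with hst
  have hmem : ∀ v, net.id v ∈ (st v).roster := by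
    intro v
    by_contra hv
    have h0 := (Set.ncard_eq_zero (Set.toFinite _)).1 (Nat.le_zero.1 (h.bounded (net.box P v)))
    exact Set.eq_empty_iff_forall_notMem.1 h0 v ⟨hv, rfl⟩
  have hcard : ∀ v, (st v).roster.ncard ≤ Δ + 1 := by
    intro v
    refine le_trans ?_ (hΔ (net.box P v))
    rw [← Set.ncard_image_of_injective _ net.id_injective]
    refine Set.ncard_le_ncard (fun i hi => ?_) (Set.toFinite _)
    obtain ⟨u, hu, rfl⟩ := h.exists_of_mem v i hi
    exact ⟨u, ⟨trivial, hu⟩, rfl⟩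
  let slot : V → Fin (Δ + 1) := fun v => slotOf Δ (st v).roster (net.id v)
  have hslot : ∀ u v, net.box P u = net.box P v → slot u = slot v → u = v := by
    intro u v hb he
    refine net.id_injective (injOn_slotOf (hcard v) ?_ (hmem v) ?_)
    · rw [← h.roster_congr u v hb]
      exact hmem u
    · simpa only [slot, h.roster_congr u v hb] using he
  refine ⟨slot, hslot, funext fun v => ?_⟩
  have hcls : ∀ v, P.classOf (P.box (st v).pos) = net.boxClass P v := fun v => by
    rw [h.pos_eq]; rfl
  rw [scoutNeighbours, Protocol.run_andThen, scoutRecord]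
  simp only [← hst, h.id_eq, hcls, h.leader_eq]
  congr 1
  funext c
  ext i
  simp only [Set.mem_ofPred_eq]
  have hheard : ∀ s x, net.heard P (fun w => if net.boxClass P w = c ∧
      slotOf Δ (st w).roster (net.id w) = s then some (enc (net.id w)) else none) v = some x ↔ _ :=
    fun s x => heard_eq_some_iff (c := c)
      (by intro w x hw; split_ifs at hw with hc; exact hc.1)
      (by
        intro w w' x y hw hw' hb
        split_ifs at hw hw' with hc hc'
        exact hslot w w' hb (hc.2.trans hc'.2.symm))
  simp only [hheard]
  constructor
  · rintro ⟨s, w, hadj, hw⟩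
    split_ifs at hw with hc
    exact ⟨w, hadj, hc.1, henc (Option.some_injective _ hw)⟩
  · rintro ⟨w, hadj, hc, rfl⟩
    exact ⟨slot w, w, hadj, if_pos ⟨hc, rfl⟩⟩

/-- Competitors share a box and are separated by their slots, so each hears all the others and can
compare identifiers. -/
theorem run_chooseGateways (henc : Function.Injective enc) {lead : V → V}
    {slot : V → Fin (Δ + 1)}
    (hslot : ∀ u v, net.box P u = net.box P v → slot u = slot v → u = v)
    {π : Protocol I M (Scout P N Δ)} (h : π.run P net input = net.scoutRecord P lead slot) (v : V) :
    (chooseGateways enc π).run P net input v =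
      (net.scoutRecord P lead slot v, net.IsGateway P v) := by
  classical
  have hne : ∀ v c, ({i | ∃ u, (net.graph P).Adj v u ∧ net.boxClass P u = c ∧ net.id u = i} :
      Set (Fin N)).Nonempty ↔ ∃ w, (net.graph P).Adj v w ∧ net.boxClass P w = c :=
    fun v c => ⟨fun ⟨_, u, hu, hc, _⟩ => ⟨u, hu, hc⟩, fun ⟨u, hu, hc⟩ => ⟨_, u, hu, hc, rfl⟩⟩
  rw [chooseGateways, Protocol.run_andThen, h]
  congr 1
  funext c
  simp only [scoutRecord, hne, IsGateway, eq_iff_iff]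
  refine and_congr_right fun hv => ?_
  have hheard : ∀ s x, net.heard P (fun w => if net.boxClass P w = net.boxClass P v ∧
      slot w = s ∧ (∃ u, (net.graph P).Adj w u ∧ net.boxClass P u = c) then
      some (enc (net.id w)) else none) v = some x ↔ _ :=
    fun s x => heard_eq_some_iff (c := net.boxClass P v)
      (by intro w x hw; split_ifs at hw with hc; exact hc.1)
      (by
        intro w w' x y hw hw' hb
        split_ifs at hw hw' with hc hc'
        exact hslot w w' hb (hc.2.1.trans hc'.2.1.symm))
  simp only [hheard]
  constructor
  · intro hall u hb hu
    rcases eq_or_ne v u with rfl | hvu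
    · exact le_rfl
    · exact hall (slot u) (net.id u)
        ⟨u, adj_of_box_eq hvu hb.symm, if_pos ⟨boxClass_congr hb, rfl, hu⟩⟩
  · rintro hall s y ⟨u, hadj, hu⟩
    split_ifs at hu with hc
    rw [← henc (Option.some_injective _ hu)]
    exact hall u (box_eq_of_adj hadj hc.1.symm).symm hc.2.2

/-- A contact role has one holder per box: the gateways of a given class that address a box from
neighbouring stations lie in one box, and only one of its stations is the gateway to that class. -/
theorem exists_run_informContacts (henc : Function.Injective enc) {lead : V → V}
    (hl : net.IsLeaderMap P lead) {slot : V → Fin (Δ + 1)}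
    (hslot : ∀ u v, net.box P u = net.box P v → slot u = slot v → u = v)
    {π : Protocol I M (Scout P N Δ × (P.BoxClass → Prop))}
    (h : ∀ v, π.run P net input v = (net.scoutRecord P lead slot v, net.IsGateway P v)) :
    ∃ role, net.IsLayout P lead slot role ∧ ∀ v,
      (informContacts enc π).run P net input v = (net.scoutRecord P lead slot v, role v) := by
  classical
  let msg : V → P.BoxClass → P.BoxClass → Option M := fun v c c' =>
    if h : net.boxClass P v = c ∧ net.IsGateway P v c' ∧
      ((net.scoutRecord P lead slot v).reach c').Nonempty then some (enc h.2.2.some) else none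
  have hmsg : ∀ v c c' x, msg v c c' = some x → net.boxClass P v = c ∧ net.IsGateway P v c' ∧
      ∃ u, (net.graph P).Adj v u ∧ net.boxClass P u = c' ∧ x = enc (net.id u) := by
    intro v c c' x hx
    simp only [msg] at hx
    split_ifs at hx with hc
    obtain ⟨u, hu, huc, hui⟩ := hc.2.2.some_mem
    refine ⟨hc.1, hc.2.1, u, hu, huc, ?_⟩
    rw [hui]
    exact (Option.some_injective _ hx).symm
  have hheard : ∀ v c c' x, net.heard P (fun w => msg w c c') v = some x ↔ _ :=
    fun v c c' x => heard_eq_some_iff (c := c) (fun w x hw => (hmsg w c c' x hw).1)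
      (fun w w' x y hw hw' hb =>
        IsGateway.unique hb (hmsg w c c' x hw).2.1 (hmsg w' c c' y hw').2.1)
  let role : V → Role P → Prop := fun v ρ => match ρ with
    | none => net.id v = net.id (lead v)
    | some (.inl c) => net.IsGateway P v c
    | some (.inr c) => net.heard P (fun w => msg w c (net.boxClass P v)) v = some (enc (net.id v))
  refine ⟨role, ⟨hl, hslot, ?_, fun v => net.id_injective.eq_iff, ?_⟩, fun v => ?_⟩
  · rintro u v (_ | c | c) hb hu hv
    · rw [net.id_injective hu, net.id_injective hv, hl.lead_eq u v hb]
    · exact IsGateway.unique hb hu hv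
    · obtain ⟨x, hux, hx⟩ := (hheard _ _ _ _).1 hu
      obtain ⟨y, hvy, hy⟩ := (hheard _ _ _ _).1 hv
      have hx' := hmsg _ _ _ _ hx
      have hy' := hmsg _ _ _ _ hy
      have hxy : x = y := IsGateway.unique
        (box_eq_of_adj_of_adj hb hux hvy (hx'.1.trans hy'.1.symm)) hx'.2.1
        (by rw [boxClass_congr hb]; exact hy'.2.1)
      rw [← hxy, ← boxClass_congr hb, hx] at hy
      exact net.id_injective (henc (Option.some_injective _ hy))
  · intro u v hadj hne
    -- The minimum is the gateway. Its contact need not be `v`, but lies in the box of `v`.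
    obtain ⟨x, ⟨hxb, hxv⟩, hmin⟩ := Set.exists_min_image
      {x | net.box P x = net.box P u ∧
        ∃ w, (net.graph P).Adj x w ∧ net.boxClass P w = net.boxClass P v}
      net.id (Set.toFinite _) ⟨u, rfl, v, hadj, rfl⟩
    have hgw : net.IsGateway P x (net.boxClass P v) :=
      ⟨hxv, fun w hw hwv => hmin w ⟨hw.trans hxb, hwv⟩⟩
    obtain ⟨z, hz⟩ : ∃ z, msg x (net.boxClass P x) (net.boxClass P v) = some z := by
      obtain ⟨w, hw, hwc⟩ := hxv
      refine ⟨_, dif_pos ⟨rfl, hgw, net.id w, w, hw, hwc, rfl⟩⟩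
    obtain ⟨-, -, y, hxy, hyc, rfl⟩ := hmsg _ _ _ _ hz
    refine ⟨x, y, hxb, box_eq_of_adj_of_adj hxb hxy hadj hyc, hxy, ⟨some (.inl _), hgw⟩,
      some (.inr (net.boxClass P x)), (hheard _ _ _ _).2 ⟨x, hxy.symm, ?_⟩⟩
    rw [hyc]
    exact hz
  · rw [informContacts, Protocol.run_andThen]
    simp only [h]
    congr 1

theorem IsLayout.run_exchangeContacts (henc : Function.Injective enc) {lead : V → V}
    {slot : V → Fin (Δ + 1)} {role : V → Role P → Prop} (hlay : net.IsLayout P lead slot role)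
    {π : Protocol I M (Scout P N Δ × (Role P → Prop))}
    (h : ∀ v, π.run P net input v = (net.scoutRecord P lead slot v, role v)) :
    (exchangeContacts enc π).run P net input = net.layoutRecord P lead slot role := by
  classical
  funext v
  rw [exchangeContacts, Protocol.run_andThen, layoutRecord]
  simp only [h, scoutRecord]
  congr 2
  funext c ρ i
  have hheard : ∀ x, net.heard P (fun w => if net.boxClass P w = c ∧ role w ρ then
      some (enc (net.id w)) else none) v = some x ↔ _ :=
    fun x => heard_eq_some_iff (c := c)
      (by intro w x hw; split_ifs at hw with hc; exact hc.1)
      (by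
        intro w w' x y hw hw' hb
        split_ifs at hw hw' with hc hc'
        exact hlay.role_unique w w' ρ hb hc.2 hc'.2)
  rw [hheard, eq_iff_iff]
  constructor
  · rintro ⟨w, hadj, hw⟩
    split_ifs at hw with hc
    exact ⟨w, hadj, hc.1, hc.2, henc (Option.some_injective _ hw)⟩
  · rintro ⟨w, hadj, hc, hρ, rfl⟩
    exact ⟨w, hadj, if_pos ⟨hc, hρ⟩⟩

end Network

/-! ### The multi-round and convergecast protocols -/

open Classical in
/-- The element that satisfies `p`, if there is one. -/
noncomputable def optionOf {X : Type*} (p : X → Prop) : Option X :=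
  if h : ∃ x, p x then some h.choose else none

theorem optionOf_eq_some_iff {X : Type*} {p : X → Prop} (hp : ∀ x y, p x → p y → x = y) {x : X} :
    optionOf p = some x ↔ p x := by
  rw [optionOf]
  split_ifs with h
  · exact ⟨fun e => Option.some_injective _ e ▸ h.choose_spec,
      fun hx => congrArg some (hp _ _ h.choose_spec hx)⟩
  · exact ⟨fun e => by simp at e, fun hx => absurd ⟨x, hx⟩ h⟩

section Construction

variable {P : SINRParams} {N Δ c : ℕ} {R : Type}

open Classical in
/-- The holder of each role transmits its message for each contact. -/
noncomputable def deliverMessages (P : SINRParams) (N Δ c : ℕ) (R : Type) :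
    Protocol (BackboneRecord N (StationMemory P N Δ) × (Fin N → Option R)) (RumorMessage R c N)
      (BackboneRecord N (StationMemory P N Δ) × (Fin N → Option R)) :=
  (Protocol.silent id).andThen (K := P.BoxClass × Role P × P.BoxClass × Role P)
    (fun a κ => if a.1.memory.boxClass = κ.1 ∧ a.1.memory.role κ.2.1 then
      (optionOf (a.1.memory.contact κ.2.2.1 κ.2.2.2)).bind fun i =>
        (a.2 i).map fun r => (some r, fun _ => false)
      else none)
    (fun a tbl => (a.1, fun i => optionOf fun r => ∃ b ρ ρ' z, a.1.memory.contact b ρ i ∧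
      a.1.memory.role ρ' ∧ tbl (b, ρ, a.1.memory.boxClass, ρ') = some (some r, z)))

open Classical in
/-- After the delivery of the messages, the leaders forward the messages they received. -/
noncomputable def multiRound (P : SINRParams) (N Δ c : ℕ) (R : Type)
    (enc : Fin N → ControlBits c N) : MultiRound c N (StationMemory P N Δ) R :=
  (deliverMessages P N Δ c R).andThen (K := P.BoxClass × P.BoxClass × Role P)
    (fun a κ => if a.1.memory.boxClass = κ.1 ∧ a.1.memory.role none then
      (optionOf (a.1.memory.contact κ.2.1 κ.2.2)).bind fun i =>
        (a.2 i).map fun r => (some r, enc i)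
      else none)
    (fun a tbl => (a.2, if a.1.memory.role none then a.2 else fun i => optionOf fun r =>
      ∃ b ρ, tbl (a.1.memory.boxClass, b, ρ) = some (some r, enc i)))

open Classical in
/-- The stations transmit their messages one by one. -/
noncomputable def convergecast (P : SINRParams) (N Δ c : ℕ) (R : Type)
    (enc : Fin N → ControlBits c N) : Convergecast c N (StationMemory P N Δ) R :=
  (Protocol.silent id).andThen (K := P.BoxClass × Fin (Δ + 1))
    (fun a κ => if a.1.memory.boxClass = κ.1 ∧ a.1.memory.slot = κ.2 then
      some (some a.2, enc a.1.memory.id) else none)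
    (fun a tbl i => if a.1.memory.role none then
      if i = a.1.memory.id then some a.2
      else optionOf fun r => ∃ s, tbl (a.1.memory.boxClass, s) = some (some r, enc i)
      else none)

end Construction

/-! ### Properties of layouts: backbone, message passing, convergecast -/

namespace Network

variable {P : SINRParams} {N Δ : ℕ} {V : Type} {net : Network N V} {lead : V → V}
  {slot : V → Fin (Δ + 1)} {role : V → Role P → Prop}

theorem isLeaderOf_layoutRecord {ℓ v : V} :
    IsLeaderOf net (net.layoutRecord P lead slot role) ℓ v ↔ lead v = ℓ :=
  net.id_injective.eq_iff

theorem mem_backboneSet_layoutRecord [Fintype V] {v : V} :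
    v ∈ backboneSet (net.layoutRecord P lead slot role) ↔ ∃ ρ, role v ρ :=
  Finset.mem_filter.trans (by simp [layoutRecord])

namespace IsLayout

theorem role_lead (h : net.IsLayout P lead slot role) (v : V) : role (lead v) none :=
  (h.role_none_iff _).2 (h.lead_lead v).symm

theorem eq_or_adj_lead (h : net.IsLayout P lead slot role) (v : V) : lead v = v ∨ (net.graph P).Adj v (lead v) := by
  by_cases hv : lead v = v
  · exact Or.inl hv
  · exact Or.inr (adj_of_box_eq (fun e => hv e.symm) (h.box_lead v).symm)

theorem optionOf_contact_eq_some_iff (h : net.IsLayout P lead slot role) {v : V} {b : P.BoxClass} {ρ : Role P} {i : Fin N} :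
    optionOf (((net.layoutRecord P lead slot role) v).memory.contact b ρ) = some i ↔
      ∃ u, (net.graph P).Adj v u ∧ net.boxClass P u = b ∧ role u ρ ∧ net.id u = i := by
  refine optionOf_eq_some_iff ?_
  rintro x y ⟨u, hu, hub, hur, rfl⟩ ⟨w, hw, hwb, hwr, rfl⟩
  exact congrArg net.id
    (h.role_unique u w ρ (box_eq_of_adj_adj hu hw (hub.trans hwb.symm)) hur hwr)

variable [Fintype V]

theorem lead_mem (h : net.IsLayout P lead slot role) (v : V) : lead v ∈ backboneSet (net.layoutRecord P lead slot role) :=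
  mem_backboneSet_layoutRecord.2 ⟨none, h.role_lead v⟩

theorem reachable_lead (h : net.IsLayout P lead slot role) {v : V} (hv : v ∈ backboneSet (net.layoutRecord P lead slot role)) :
    ((net.graph P).induce
      (backboneSet (net.layoutRecord P lead slot role) : Set V)).Reachable
      ⟨v, hv⟩ ⟨lead v, h.lead_mem v⟩ := by
  rcases h.eq_or_adj_lead v with he | hadj
  · simp only [he]
    exact SimpleGraph.Reachable.refl _
  · exact SimpleGraph.Adj.reachable (SimpleGraph.induce_adj.2 hadj)

/-- Along a walk, a step inside a box keeps the leader, and a step between boxes is replaced by a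
path from leader to leader over a bridge. -/
theorem reachable_lead_lead (h : net.IsLayout P lead slot role) {u v : V} (huv : (net.graph P).Reachable u v) :
    ((net.graph P).induce
      (backboneSet (net.layoutRecord P lead slot role) : Set V)).Reachable
      ⟨lead u, h.lead_mem u⟩ ⟨lead v, h.lead_mem v⟩ := by
  obtain ⟨p⟩ := huv
  induction p with
  | nil => exact SimpleGraph.Reachable.refl _
  | @cons u v w hadj _ ih =>
    refine SimpleGraph.Reachable.trans ?_ ih
    by_cases hb : net.box P u = net.box P v
    · simp only [h.lead_eq u v hb]
      exact SimpleGraph.Reachable.refl _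
    · obtain ⟨x, y, hx, hy, hxy, hxr, hyr⟩ := h.exists_bridge u v hadj hb
      have h1 := h.reachable_lead (mem_backboneSet_layoutRecord.2 hxr)
      have h2 := h.reachable_lead (mem_backboneSet_layoutRecord.2 hyr)
      simp only [h.lead_eq x u hx] at h1
      simp only [h.lead_eq y v hy] at h2
      refine h1.symm.trans (SimpleGraph.Reachable.trans ?_ h2)
      exact SimpleGraph.Adj.reachable (SimpleGraph.induce_adj.2 hxy)

theorem isConnectedDominatingSet (h : net.IsLayout P lead slot role) (hG : (net.graph P).Connected) :
    IsConnectedDominatingSet (net.graph P)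
      (backboneSet (net.layoutRecord P lead slot role)) := by
  refine ⟨?_, fun v hv => ⟨lead v, h.lead_mem v, ?_⟩⟩
  · obtain ⟨v₀⟩ := hG.nonempty
    rw [SimpleGraph.connected_iff]
    refine ⟨fun u v => ?_, ⟨⟨lead v₀, h.lead_mem v₀⟩⟩⟩
    exact (h.reachable_lead u.2).trans
      ((h.reachable_lead_lead (hG.preconnected u.1 v.1)).trans (h.reachable_lead v.2).symm)
  · exact (h.eq_or_adj_lead v).resolve_left fun e => hv (e ▸ h.lead_mem v)

open Finset in
-- A backbone station is determined by a dominator in `D`, its box offset from that dominator (`5 ^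
-- 2 = 25` possibilities) and one of its roles.
theorem card_backboneSet_le (h : net.IsLayout P lead slot role) {D : Finset V}
    (hD : ∀ v, v ∉ D → ∃ u ∈ D, (net.graph P).Adj v u) :
    #(backboneSet (net.layoutRecord P lead slot role)) ≤ 25 * Fintype.card (Role P) * #D := by
  classical
  have hdom : ∀ v, ∃ u ∈ D, ∀ i, |net.box P v i - net.box P u i| ≤ 2 := by
    intro v
    by_cases hv : v ∈ D
    · exact ⟨v, hv, fun i => by simp⟩
    · obtain ⟨u, hu, hadj⟩ := hD v hv
      exact ⟨u, hu, abs_box_sub_le_two hadj⟩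
  choose dom hdomD hdom using hdom
  have hrole : ∀ v, ∃ ρ, v ∈ backboneSet (net.layoutRecord P lead slot role) → role v ρ := by
    intro v
    by_cases hv : v ∈ backboneSet (net.layoutRecord P lead slot role)
    · obtain ⟨ρ, hρ⟩ := mem_backboneSet_layoutRecord.1 hv
      exact ⟨ρ, fun _ => hρ⟩
    · exact ⟨none, fun hv' => absurd hv' hv⟩
  choose ρ hρ using hrole
  let offsets : Finset (Fin 2 → ℤ) := Fintype.piFinset fun _ => Icc (-2) 2
  have hcard : #(D ×ˢ offsets ×ˢ (univ : Finset (Role P))) =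
      25 * Fintype.card (Role P) * #D := by
    rw [card_product, card_product, card_univ, Fintype.card_piFinset]
    have h5 : (2 + 1 - -2 : ℤ).toNat = 5 := rfl
    simp only [Int.card_Icc, h5, prod_const, card_univ, Fintype.card_fin]
    ring
  rw [← hcard]
  refine card_le_card_of_injOn (fun v => (dom v, net.box P v - net.box P (dom v), ρ v)) ?_ ?_
  · intro v _
    refine mem_coe.2 (mem_product.2 ⟨hdomD v, mem_product.2 ⟨?_, mem_univ _⟩⟩)
    exact Fintype.mem_piFinset.2 fun i => mem_Icc.2 (abs_le.1 (hdom v i))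
  · intro v hv w hw he
    simp only [Prod.mk.injEq] at he
    obtain ⟨h1, h2, h3⟩ := he
    rw [h1] at h2
    exact h.role_unique v w (ρ v) (sub_left_inj.1 h2) (hρ v hv) (h3 ▸ hρ w hw)

theorem isBackbone (h : net.IsLayout P lead slot role) (hG : (net.graph P).Connected) {c : ℕ}
    (hc : 25 * Fintype.card (Role P) ≤ c) :
    IsBackbone P c net (net.layoutRecord P lead slot role) := by
  refine ⟨h.isConnectedDominatingSet hG, fun D hD =>
    (h.card_backboneSet_le hD.2).trans (Nat.mul_le_mul_right _ hc), fun v =>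
    ⟨lead v, ⟨isLeaderOf_layoutRecord.2 rfl, h.lead_mem v, h.eq_or_adj_lead v,
      isLeaderOf_layoutRecord.2 (h.lead_lead v)⟩, fun ℓ hℓ => (isLeaderOf_layoutRecord.1 hℓ.1).symm⟩⟩

/-- The key holds class and role of sender and receiver, which identify each end among the
neighbours of the other, so no control bits are needed. A station with several roles only causes
repeated copies of the same message. -/
theorem run_deliverMessages (h : net.IsLayout P lead slot role) {c : ℕ} {R : Type} (m : V → Fin N → Option R) :
    ∃ inbox : V → Fin N → Option R,
      (∀ v, (deliverMessages P N Δ c R).run P net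
        (fun u => (net.layoutRecord P lead slot role u, m u)) v =
        (net.layoutRecord P lead slot role v, inbox v)) ∧
      ∀ v ∈ backboneSet (net.layoutRecord P lead slot role), ∀ i r, inbox v i = some r ↔
        Delivered P net (net.layoutRecord P lead slot role) m v i r := by
  classical
  refine ⟨_, fun v => Protocol.run_andThen _ _ _ _ _ _ _, fun v hv i r => ?_⟩
  simp only [Protocol.run_silent, id_eq]
  have hheard : ∀ (b : P.BoxClass) (ρ : Role P) (b' : P.BoxClass) (ρ' : Role P)
      (x : RumorMessage R c N), _ ↔ _ := fun b ρ b' ρ' x =>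
    heard_eq_some_iff (P := P) (net := net) (u := v) (x := x) (c := b)
      (msg := fun w => if (net.layoutRecord P lead slot role w).memory.boxClass = b ∧
        (net.layoutRecord P lead slot role w).memory.role ρ then
          (optionOf ((net.layoutRecord P lead slot role w).memory.contact b' ρ')).bind fun i =>
            (m w i).map fun r => (some r, fun _ => false) else none)
      (by intro w x hw; split_ifs at hw with hc; exact hc.1)
      (by
        intro w w' x y hw hw' hb
        split_ifs at hw hw' with hc hc'
        exact h.role_unique w w' ρ hb hc.2 hc'.2)
  have hrel : ∀ r, (∃ b ρ ρ' z, (net.layoutRecord P lead slot role v).memory.contact b ρ i ∧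
      (net.layoutRecord P lead slot role v).memory.role ρ' ∧
      net.heard P (fun w => if (net.layoutRecord P lead slot role w).memory.boxClass = b ∧
        (net.layoutRecord P lead slot role w).memory.role ρ then
          (optionOf ((net.layoutRecord P lead slot role w).memory.contact
            (net.layoutRecord P lead slot role v).memory.boxClass ρ')).bind fun i =>
            (m w i).map fun r => ((some r, fun _ => false) : RumorMessage R c N) else none) v =
        some (some r, z)) ↔
      Delivered P net (net.layoutRecord P lead slot role) m v i r := by
    intro r
    constructor
    · rintro ⟨b, ρ, ρ', z, ⟨u, hvu, hub, huρ, rfl⟩, hvρ, hx⟩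
      obtain ⟨w, hvw, hw⟩ := (hheard _ _ _ _ _).1 hx
      split_ifs at hw with hc
      have hwu : w = u :=
        h.role_unique w u ρ (box_eq_of_adj_adj hvw hvu (hc.1.trans hub.symm)) hc.2 huρ
      subst hwu
      obtain ⟨i, hi, hmi⟩ := Option.bind_eq_some_iff.1 hw
      obtain ⟨y, hwy, hyb, hyρ, rfl⟩ := h.optionOf_contact_eq_some_iff.1 hi
      have hyv : y = v := h.role_unique y v ρ' (box_eq_of_adj_adj hwy hvw.symm hyb) hyρ hvρ
      subst hyv
      obtain ⟨r', hr', he⟩ := Option.map_eq_some_iff.1 hmi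
      simp only [Prod.mk.injEq, Option.some.injEq] at he
      exact ⟨w, mem_backboneSet_layoutRecord.2 ⟨ρ, huρ⟩, hvw.symm, rfl, he.1 ▸ hr'⟩
    · rintro ⟨u, hu, huv, rfl, hr⟩
      obtain ⟨ρ, hρ⟩ := mem_backboneSet_layoutRecord.1 hu
      obtain ⟨ρ', hρ'⟩ := mem_backboneSet_layoutRecord.1 hv
      refine ⟨net.boxClass P u, ρ, ρ', fun _ => false, ⟨u, huv.symm, rfl, hρ, rfl⟩, hρ',
        (hheard _ _ _ _ _).2 ⟨u, huv.symm, ?_⟩⟩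
      rw [if_pos ⟨rfl, hρ⟩, (h.optionOf_contact_eq_some_iff
        (b := (net.layoutRecord P lead slot role v).memory.boxClass)).2 ⟨v, huv, rfl, hρ', rfl⟩]
      simp [hr]
  rw [← hrel]
  refine optionOf_eq_some_iff fun r r' hr hr' => ?_
  obtain ⟨u, -, -, hui, hur⟩ := (hrel r).1 hr
  obtain ⟨w, -, -, hwi, hwr⟩ := (hrel r').1 hr'
  rw [net.id_injective (hui.trans hwi.symm), hwr] at hur
  exact (Option.some_injective _ hur).symm

/-- The leader's inbox has at most one entry per class and role of the sender, so forwarding takes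
constantly many rounds. The sender is now put into the control bits, since the other stations of the
box need not share the leader's contacts. -/
theorem simulatesMessagePassing (h : net.IsLayout P lead slot role) {c : ℕ} {R : Type} {enc : Fin N → ControlBits c N}
    (henc : Function.Injective enc) :
    SimulatesMessagePassing P net (net.layoutRecord P lead slot role)
      (multiRound P N Δ c R enc) := by
  classical
  intro m
  obtain ⟨inbox, hrun, hinbox⟩ := h.run_deliverMessages (c := c) m
  refine ⟨fun v hv i r => ?_, fun w ℓ hℓ i r => ?_⟩
  · rw [multiRound, Protocol.run_andThen, hrun]
    exact hinbox v hv i r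
  · obtain rfl := isLeaderOf_layoutRecord.1 hℓ
    rw [← hinbox _ (h.lead_mem w), multiRound, Protocol.run_andThen]
    simp only [hrun]
    by_cases hw : role w none
    · have : lead w = w := ((h.role_none_iff w).1 hw).symm
      rw [if_pos (show (net.layoutRecord P lead slot role w).memory.role none from hw), this]
    rw [if_neg (show ¬ (net.layoutRecord P lead slot role w).memory.role none from hw)]
    have hwl : w ≠ lead w := fun e => hw ((h.role_none_iff w).2 e)
    have hrel : ∀ r, (∃ b ρ, net.heard P (fun v =>
        if (net.layoutRecord P lead slot role v).memory.boxClass =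
          (net.layoutRecord P lead slot role w).memory.boxClass ∧
          (net.layoutRecord P lead slot role v).memory.role none then
          (optionOf ((net.layoutRecord P lead slot role v).memory.contact b ρ)).bind fun i =>
            (inbox v i).map fun r => ((some r, enc i) : RumorMessage R c N) else none) w =
        some (some r, enc i)) ↔ inbox (lead w) i = some r := by
      intro r
      have hheard : ∀ (b : P.BoxClass) (ρ : Role P) (x : RumorMessage R c N), _ ↔ _ :=
        fun b ρ x => heard_eq_some_iff (P := P) (net := net) (u := w) (x := x)
          (c := net.boxClass P w)
          (msg := fun v => if (net.layoutRecord P lead slot role v).memory.boxClass =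
            (net.layoutRecord P lead slot role w).memory.boxClass ∧
            (net.layoutRecord P lead slot role v).memory.role none then
            (optionOf ((net.layoutRecord P lead slot role v).memory.contact b ρ)).bind fun i =>
              (inbox v i).map fun r => (some r, enc i) else none)
          (by intro w x hw; split_ifs at hw with hc; exact hc.1)
          (by
            intro w w' x y hw hw' hb
            split_ifs at hw hw' with hc hc'
            exact h.role_unique w w' none hb hc.2 hc'.2)
      constructor
      · rintro ⟨b, ρ, hx⟩
        obtain ⟨v, hwv, hv⟩ := (hheard _ _ _).1 hx
        split_ifs at hv with hc
        have hvl : v = lead w := by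
          rw [(h.role_none_iff v).1 hc.2]
          exact h.lead_eq _ _ (box_eq_of_adj hwv hc.1.symm).symm
        subst hvl
        obtain ⟨i', -, hmi⟩ := Option.bind_eq_some_iff.1 hv
        obtain ⟨r', hr', he⟩ := Option.map_eq_some_iff.1 hmi
        simp only [Prod.mk.injEq, Option.some.injEq] at he
        rw [← henc he.2, ← he.1]
        exact hr'
      · intro hr
        obtain ⟨u, hu, hadj, rfl, -⟩ := (hinbox _ (h.lead_mem w) i r).1 hr
        obtain ⟨ρ, hρ⟩ := mem_backboneSet_layoutRecord.1 hu
        refine ⟨net.boxClass P u, ρ, (hheard _ _ _).2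
          ⟨lead w, adj_of_box_eq hwl (h.box_lead w).symm, ?_⟩⟩
        rw [if_pos ⟨boxClass_congr (h.box_lead w), h.role_lead w⟩,
          h.optionOf_contact_eq_some_iff.2 ⟨u, hadj.symm, rfl, hρ, rfl⟩]
        simp [hr]
    rw [← hrel]
    refine optionOf_eq_some_iff fun r r' hr hr' => ?_
    have := ((hrel r).1 hr).symm.trans ((hrel r').1 hr')
    exact Option.some_injective _ this

/-- Slots separate the stations of a box, and its leader is adjacent to all the others. Its own
message it cannot hear; that entry is read off its input. -/
theorem collectsAtLeaders (h : net.IsLayout P lead slot role) {c : ℕ} {R : Type} {enc : Fin N → ControlBits c N}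
    (henc : Function.Injective enc) :
    CollectsAtLeaders P net (net.layoutRecord P lead slot role)
      (convergecast P N Δ c R enc) := by
  classical
  intro m ℓ i r
  simp only [isLeaderOf_layoutRecord]
  rw [convergecast, Protocol.run_andThen]
  simp only [Protocol.run_silent, id_eq]
  by_cases hℓ : role ℓ none
  swap
  · rw [if_neg (show ¬ (net.layoutRecord P lead slot role ℓ).memory.role none from hℓ)]
    refine ⟨fun e => by simp at e, ?_⟩
    rintro ⟨v, rfl, -⟩
    exact absurd (h.role_lead v) hℓ
  rw [if_pos (show (net.layoutRecord P lead slot role ℓ).memory.role none from hℓ)]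
  have hℓ' := (h.role_none_iff ℓ).1 hℓ
  by_cases hi : i = net.id ℓ
  · rw [if_pos (show i = (net.layoutRecord P lead slot role ℓ).memory.id from hi)]
    subst hi
    constructor
    · intro e
      exact ⟨ℓ, hℓ'.symm, rfl, Option.some_injective _ e⟩
    · rintro ⟨v, -, hv, rfl⟩
      rw [net.id_injective hv]
  rw [if_neg (show ¬ i = (net.layoutRecord P lead slot role ℓ).memory.id from hi)]
  have hrel : ∀ r, (∃ s, net.heard P (fun v =>
      if (net.layoutRecord P lead slot role v).memory.boxClass =
        (net.layoutRecord P lead slot role ℓ).memory.boxClass ∧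
        (net.layoutRecord P lead slot role v).memory.slot = s then
        ((some (some (m v), enc (net.layoutRecord P lead slot role v).memory.id)) :
          Option (RumorMessage R c N)) else none) ℓ =
      some (some r, enc i)) ↔ ∃ v, lead v = ℓ ∧ net.id v = i ∧ m v = r := by
    intro r
    have hheard : ∀ (s : Fin (Δ + 1)) (x : RumorMessage R c N), _ ↔ _ :=
      fun s x => heard_eq_some_iff (P := P) (net := net) (u := ℓ) (x := x)
        (c := net.boxClass P ℓ)
        (msg := fun v => if (net.layoutRecord P lead slot role v).memory.boxClass =
          (net.layoutRecord P lead slot role ℓ).memory.boxClass ∧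
          (net.layoutRecord P lead slot role v).memory.slot = s then
          some (some (m v), enc (net.layoutRecord P lead slot role v).memory.id) else none)
        (by intro w x hw; split_ifs at hw with hc; exact hc.1)
        (by
          intro w w' x y hw hw' hb
          split_ifs at hw hw' with hc hc'
          exact h.slot_inj w w' hb (hc.2.trans hc'.2.symm))
    constructor
    · rintro ⟨s, hs⟩
      obtain ⟨v, hadj, hv⟩ := (hheard _ _).1 hs
      split_ifs at hv with hc
      simp only [Option.some.injEq, Prod.mk.injEq] at hv
      refine ⟨v, ?_, henc hv.2, hv.1⟩
      rw [h.lead_eq v ℓ (box_eq_of_adj hadj hc.1.symm).symm, ← hℓ']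
    · rintro ⟨v, rfl, rfl, rfl⟩
      exact ⟨slot v, (hheard _ _).2 ⟨v, adj_of_box_eq (fun e => hi (congrArg net.id e.symm))
        (h.box_lead v), if_pos ⟨(boxClass_congr (h.box_lead v)).symm, rfl⟩⟩⟩
  rw [← hrel]
  refine optionOf_eq_some_iff fun r r' hr hr' => ?_
  obtain ⟨u, -, hui, hur⟩ := (hrel r).1 hr
  obtain ⟨w, -, hwi, hwr⟩ := (hrel r').1 hr'
  rw [← hur, ← hwr, net.id_injective (hui.trans hwi.symm)]

end IsLayout

end Network

/-! ### Round counts and assembly -/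

theorem exists_controlBits_encoding {c : ℕ} (hc : 0 < c) (N : ℕ) :
    ∃ enc : Fin N → ControlBits c N, Function.Injective enc := by
  obtain ⟨e⟩ := Function.Embedding.nonempty_of_card_le (α := Fin N) (β := ControlBits c N) (by
    rw [Fintype.card_fin, Fintype.card_fun, Fintype.card_bool, Fintype.card_fin]
    exact (Nat.lt_pow_succ_log_self (by norm_num) N).le.trans
      (Nat.pow_le_pow_right (by norm_num) (Nat.le_mul_of_pos_left _ hc)))
  exact ⟨e, e.injective⟩

section Construction

variable {P : SINRParams} {N Δ : ℕ} {M : Type}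

/-- The construction of the backbone. -/
noncomputable def backboneProtocol (P : SINRParams) (Δ : ℕ) (enc : Fin N → M) {q : ℕ → ℕ}
    (F : ∀ i, HashFamily N (2 ^ i) (q i)) (m : ℕ) :
    Protocol (Fin N × Plane) M (BackboneRecord N (StationMemory P N Δ)) :=
  exchangeContacts enc <| informContacts enc <| chooseGateways enc <| scoutNeighbours P Δ enc <|
    runStages (fun i => enrollStage P enc (F i)) m <| announceLeaders P enc <|
      runStages (fun i => electStage P enc (F i)) m <| Protocol.silent fun x => ⟨x.1, x.2, True⟩

/-- The factor `3` counts one pass over the hash keys per election stage and two per enrollment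
stage, the second being the echo. -/
theorem rounds_backboneProtocol_le (enc : Fin N → M) {B : ℕ}
    (F : ∀ i, HashFamily N (2 ^ i) (B * 2 ^ i)) (m : ℕ) :
    (backboneProtocol P Δ enc F m).rounds ≤
      3 * (Fintype.card P.BoxClass * (Nat.log 2 N + 1) * B * 2 ^ m) +
      (Fintype.card P.BoxClass + Fintype.card P.BoxClass * (Δ + 1) +
        Fintype.card P.BoxClass * ((Δ + 1) * Fintype.card P.BoxClass) +
        Fintype.card P.BoxClass * Fintype.card P.BoxClass +
        Fintype.card P.BoxClass * Fintype.card (Role P)) := by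
  have hkey : ∀ i, Fintype.card (HashKey P N (B * 2 ^ i)) =
      Fintype.card P.BoxClass * (Nat.log 2 N + 1) * B * 2 ^ i := fun i => by
    rw [Fintype.card_prod, Fintype.card_prod, Fintype.card_fin, Fintype.card_fin]
    ring
  have h1 := rounds_runStages_le (stage := fun i => electStage (I := Fin N × Plane) P enc (F i))
    (a := Fintype.card P.BoxClass * (Nat.log 2 N + 1) * B)
    (fun i π => by rw [← hkey]; exact le_rfl) m (Protocol.silent fun x => ⟨x.1, x.2, True⟩)
  have h2 := rounds_runStages_le (stage := fun i => enrollStage (I := Fin N × Plane) P enc (F i))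
    (a := 2 * (Fintype.card P.BoxClass * (Nat.log 2 N + 1) * B))
    (fun i π => by
      rw [mul_assoc, ← hkey, two_mul, ← add_assoc]
      exact le_rfl) m (announceLeaders P enc <|
      runStages (fun i => electStage P enc (F i)) m <| Protocol.silent fun x => ⟨x.1, x.2, True⟩)
  have h3 : (announceLeaders P enc <| runStages (fun i => electStage P enc (F i)) m <|
      Protocol.silent fun x : Fin N × Plane => ⟨x.1, x.2, True⟩).rounds =
      (runStages (fun i => electStage P enc (F i)) m <|
        Protocol.silent fun x : Fin N × Plane => ⟨x.1, x.2, True⟩).rounds +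
        Fintype.card P.BoxClass := rfl
  have h4 : (backboneProtocol P Δ enc F m).rounds =
      (runStages (fun i => enrollStage P enc (F i)) m <| announceLeaders P enc <|
        runStages (fun i => electStage P enc (F i)) m <|
        Protocol.silent fun x : Fin N × Plane => ⟨x.1, x.2, True⟩).rounds +
      Fintype.card (P.BoxClass × Fin (Δ + 1)) +
      Fintype.card (P.BoxClass × Fin (Δ + 1) × P.BoxClass) +
      Fintype.card (P.BoxClass × P.BoxClass) + Fintype.card (P.BoxClass × Role P) := rfl
  simp only [Fintype.card_prod (P.BoxClass), Fintype.card_prod (Fin (Δ + 1)),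
    Fintype.card_fin] at h4
  have h5 : (Protocol.silent fun x : Fin N × Plane => (⟨x.1, x.2, True⟩ : Candidate N) :
    Protocol (Fin N × Plane) M (Candidate N)).rounds = 0 := rfl
  rw [h5] at h1
  rw [h3] at h2
  linarith

end Construction

namespace Network

variable {P : SINRParams} {N Δ : ℕ} {V : Type} {net : Network N V}

/-- For `Δ = 0` the bounds `c * Δ` allow no rounds at all, so this case is treated separately. -/
theorem Admissible.subsingleton [Finite V] (h : net.Admissible P 0) : Subsingleton V := by
  refine ⟨fun u v => ?_⟩
  by_contra hne
  obtain ⟨p⟩ := h.1.preconnected u v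
  cases p with
  | nil => exact hne rfl
  | @cons _ w _ hadj _ =>
    have h0 := (Set.ncard_eq_zero (Set.toFinite _)).1 (Nat.le_zero.1 (h.2 u))
    exact Set.eq_empty_iff_forall_notMem.1 h0 w hadj

variable [Fintype V]

theorem Admissible.boxBounded (h : net.Admissible P Δ) : net.BoxBounded P Set.univ (Δ + 1) := by
  intro b
  rcases {v | v ∈ Set.univ ∧ net.box P v = b}.eq_empty_or_nonempty with h0 | ⟨u, -, hu⟩
  · rw [h0]
    simp
  · refine le_trans (Set.ncard_le_ncard (t := insert u ((net.graph P).neighborSet u)) ?_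
      (Set.toFinite _)) ((Set.ncard_insert_le _ _).trans (Nat.add_le_add_right (h.2 u) 1))
    rintro v ⟨-, hv⟩
    rcases eq_or_ne v u with rfl | hne
    · exact Set.mem_insert _ _
    · exact Set.mem_insert_of_mem _ (adj_of_box_eq hne (hv.trans hu.symm)).symm

theorem Admissible.exists_run_backboneProtocol (h : net.Admissible P Δ) {M : Type}
    {enc : Fin N → M} (henc : Function.Injective enc) {q : ℕ → ℕ}
    (F : ∀ i, HashFamily N (2 ^ i) (q i)) {m : ℕ} (hm : Δ + 1 ≤ 2 ^ m) :
    ∃ (lead : V → V) (slot : V → Fin (Δ + 1)) (role : V → Role P → Prop),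
      net.IsLayout P lead slot role ∧
      (backboneProtocol P Δ enc F (m + 1)).run P net (fun v => (net.id v, net.pos v)) =
        net.layoutRecord P lead slot role := by
  have h0 : net.IsCandidacy P (2 ^ m)
      ((Protocol.silent fun x => ⟨x.1, x.2, True⟩ : Protocol (Fin N × Plane) M _).run P net
        fun v => (net.id v, net.pos v)) :=
    ⟨fun v => rfl, fun v => rfl, h.boxBounded.mono hm, fun v => ⟨v, rfl, trivial⟩⟩
  have h1 := isCandidacy_runStages henc F h0
  obtain ⟨lead, hlead, h2⟩ := exists_isEnrollment_announceLeaders henc h1 (h.boxBounded.mono hm)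
  have h3 := isEnrollment_runStages henc hlead F h2
  obtain ⟨slot, hslot, h4⟩ := exists_run_scoutNeighbours henc h3 h.boxBounded
  obtain ⟨role, hlay, h5⟩ := exists_run_informContacts henc hlead hslot
    (run_chooseGateways henc hslot h4)
  exact ⟨lead, slot, role, hlay, hlay.run_exchangeContacts henc h5⟩

end Network

/-- If the degrees are `0`, then there is only one station, and no communication is necessary. -/
theorem exists_backbone_of_degree_zero (P : SINRParams) {c : ℕ} (hc : 0 < c) (N : ℕ) :
    ∃ (Q : Type) (build : BackboneBuilder c N Q), build.rounds = 0 ∧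
      (∀ (V : Type) [Fintype V] (net : Network N V), net.Admissible P 0 →
        IsBackbone P c net (build.records P net)) ∧
      ∀ R : Type,
        (∃ multi : MultiRound c N Q R, multi.rounds = 0 ∧
          ∀ (V : Type) [Fintype V] (net : Network N V), net.Admissible P 0 →
            SimulatesMessagePassing P net (build.records P net) multi) ∧
        (∃ conv : Convergecast c N Q R, conv.rounds = 0 ∧
          ∀ (V : Type) [Fintype V] (net : Network N V), net.Admissible P 0 →
            CollectsAtLeaders P net (build.records P net) conv) := by
  refine ⟨Unit, Protocol.silent fun x => ⟨true, x.1, ()⟩, rfl, fun V _ net h => ?_, fun R =>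
    ⟨⟨Protocol.silent fun _ => (fun _ => none, fun _ => none), rfl, fun V _ net h => ?_⟩,
      ⟨Protocol.silent fun a i => if i = a.1.leader then some a.2 else none, rfl,
        fun V _ net h => ?_⟩⟩⟩
  all_goals have hsub := h.subsingleton
  · have hall : ∀ v, v ∈ backboneSet (BackboneBuilder.records (c := c) (Q := Unit)
        (Protocol.silent fun x => ⟨true, x.1, ()⟩) P net) :=
      fun v => Finset.mem_filter.2 ⟨Finset.mem_univ v, rfl⟩
    refine ⟨⟨?_, fun v hv => absurd (hall v) hv⟩, fun D hD => ?_, fun v =>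
      ⟨v, ⟨rfl, hall v, Or.inl rfl, rfl⟩, fun ℓ _ => Subsingleton.elim _ _⟩⟩
    · obtain ⟨v₀⟩ := h.1.nonempty
      rw [SimpleGraph.connected_iff]
      exact ⟨fun u v => by rw [Subsingleton.elim u v], ⟨⟨v₀, hall v₀⟩⟩⟩
    · have h1 := Finset.card_le_one_of_subsingleton (backboneSet
        (BackboneBuilder.records (c := c) (Q := Unit)
          (Protocol.silent fun x => ⟨true, x.1, ()⟩) P net))
      obtain ⟨⟨v, hv⟩⟩ := hD.1.nonempty
      have h2 : 0 < D.card := Finset.card_pos.2 ⟨v, hv⟩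
      exact h1.trans (Nat.mul_pos hc h2)
  · have hno : ∀ (m : V → Fin N → Option R) v i r, ¬ Delivered P net (BackboneBuilder.records
        (c := c) (Q := Unit) (Protocol.silent fun x => ⟨true, x.1, ()⟩) P net) m v i r := by
      rintro m v i r ⟨u, -, hadj, -⟩
      exact hadj.1 (Subsingleton.elim _ _)
    refine fun m => ⟨fun v _ i r => ?_, fun w ℓ _ i r => ?_⟩
    · exact iff_of_false (fun e => by cases e) (hno m v i r)
    · exact iff_of_false (fun e => by cases e) (hno m ℓ i r)
  · intro m ℓ i r
    rw [Protocol.run_silent]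
    change (if i = net.id ℓ then some (m ℓ) else none) = some r ↔ _
    constructor
    · intro e
      split_ifs at e with hi
      exact ⟨ℓ, rfl, hi.symm, Option.some_injective _ e⟩
    · rintro ⟨v, -, rfl, rfl⟩
      rw [Subsingleton.elim v ℓ, if_pos rfl]

theorem mainTheorem2 (P : SINRParams) :
    ∃ c k : ℕ, ∀ N Δ : ℕ,
      ∃ (Q : Type) (build : BackboneBuilder c N Q),
        build.rounds ≤ c * Δ * (Nat.log 2 N + 1) ^ k ∧
        (∀ (V : Type) [Fintype V] (net : Network N V), net.Admissible P Δ →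
          IsBackbone P c net (build.records P net)) ∧
        ∀ R : Type,
          (∃ multi : MultiRound c N Q R,
            multi.rounds ≤ c ∧
            ∀ (V : Type) [Fintype V] (net : Network N V), net.Admissible P Δ →
              SimulatesMessagePassing P net (build.records P net) multi) ∧
          (∃ conv : Convergecast c N Q R,
            conv.rounds ≤ c * Δ ∧
            ∀ (V : Type) [Fintype V] (net : Network N V), net.Admissible P Δ →
              CollectsAtLeaders P net (build.records P net) conv) := by
  obtain ⟨B, hB⟩ : ∃ B : ℕ, B = 2 ^ 64 := ⟨_, rfl⟩
  obtain ⟨D, hD⟩ : ∃ D, D = Fintype.card P.BoxClass := ⟨_, rfl⟩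
  obtain ⟨ρ, hρ⟩ : ∃ ρ, ρ = Fintype.card (Role P) := ⟨_, rfl⟩
  -- The terms before the bracket bound the construction, with `12 = 3 * 4` from `2 ^ (m + 1) ≤ 4 *
  -- Δ`; the bracket is the length of a multi-round, `25 * ρ` the size ratio, and `1` ensures
  -- positivity. The `2 * D` of the convergecast is covered by `3 * D`.
  obtain ⟨c, hc⟩ : ∃ c, c = 12 * (D * B) + 3 * D + 3 * (D * D) + D * ρ +
      (D * (ρ * (D * ρ)) + D * (D * ρ)) + 25 * ρ + 1 := ⟨_, rfl⟩
  have hcpos : 0 < c := by omega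
  refine ⟨c, 1, fun N Δ => ?_⟩
  rcases Nat.eq_zero_or_pos Δ with rfl | hΔ
  · obtain ⟨Q, build, hr, hb, hR⟩ := exists_backbone_of_degree_zero P hcpos N
    refine ⟨Q, build, by rw [hr]; exact Nat.zero_le _, hb, fun R => ?_⟩
    obtain ⟨⟨multi, hm, hm'⟩, ⟨conv, hv, hv'⟩⟩ := hR R
    exact ⟨⟨multi, by rw [hm]; exact Nat.zero_le _, hm'⟩,
      ⟨conv, by rw [hv]; exact Nat.zero_le _, hv'⟩⟩
  obtain ⟨enc, henc⟩ := exists_controlBits_encoding hcpos N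
  have hF : ∀ i, Nonempty (HashFamily N (2 ^ i) (B * 2 ^ i)) := fun i => by
    obtain ⟨f, hf⟩ := exists_hash_family N (2 ^ i) B _ (by positivity) hB rfl
    exact ⟨⟨f, hf⟩⟩
  let F := fun i => (hF i).some
  -- The stages start from a power of two that bounds the size `Δ + 1` of a box and is at most `2 *
  -- Δ`.
  set m := Nat.log 2 Δ + 1 with hm
  have hm1 : Δ + 1 ≤ 2 ^ m := Nat.lt_pow_succ_log_self (by norm_num) Δ
  have hm2 : 2 ^ (m + 1) ≤ 4 * Δ := by
    have := Nat.pow_log_le_self 2 hΔ.ne'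
    rw [hm, pow_succ, pow_succ]
    omega
  refine ⟨_, backboneProtocol P Δ enc F (m + 1), ?_, fun V _ net h => ?_, fun R =>
    ⟨⟨multiRound P N Δ c R enc, ?_, fun V _ net h => ?_⟩,
      ⟨convergecast P N Δ c R enc, ?_, fun V _ net h => ?_⟩⟩⟩
  · refine (rounds_backboneProtocol_le enc F (m + 1)).trans ?_
    rw [← hD, ← hρ, pow_one]
    set L := Nat.log 2 N + 1 with hL
    have hΔL : Δ ≤ Δ * L := Nat.le_mul_of_pos_right _ (Nat.succ_pos _)
    have h1L : 1 ≤ Δ * L := hΔ.trans_le hΔL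
    calc _ ≤ 3 * (D * L * B * (4 * Δ)) + (D * (Δ * L) + D * (2 * (Δ * L)) +
          D * (2 * (Δ * L) * D) + D * D * (Δ * L) + D * ρ * (Δ * L)) := by
          have h2 : Δ + 1 ≤ 2 * (Δ * L) := by omega
          have h3 : ∀ x, x ≤ x * (Δ * L) := fun x => Nat.le_mul_of_pos_right x h1L
          refine Nat.add_le_add (by gcongr) (Nat.add_le_add (Nat.add_le_add (Nat.add_le_add
            (Nat.add_le_add (h3 _) ?_) ?_) (h3 _)) (h3 _))
          · gcongr
          · gcongr
      _ = (12 * (D * B) + 3 * D + 3 * (D * D) + D * ρ) * (Δ * L) := by ring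
      _ ≤ c * (Δ * L) := Nat.mul_le_mul_right _ (by omega)
      _ = c * Δ * L := (mul_assoc _ _ _).symm
  · obtain ⟨lead, slot, role, hlay, hrun⟩ := h.exists_run_backboneProtocol henc F hm1
    rw [BackboneBuilder.records, hrun]
    exact hlay.isBackbone h.1 (by omega)
  · have h1 : (multiRound P N Δ c R enc).rounds =
        0 + Fintype.card (P.BoxClass × Role P × P.BoxClass × Role P) +
          Fintype.card (P.BoxClass × P.BoxClass × Role P) := rfl
    have h2 : Fintype.card (P.BoxClass × Role P × P.BoxClass × Role P) = D * (ρ * (D * ρ)) := by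
      rw [Fintype.card_prod, Fintype.card_prod, Fintype.card_prod, hD, hρ]
    have h3 : Fintype.card (P.BoxClass × P.BoxClass × Role P) = D * (D * ρ) := by
      rw [Fintype.card_prod, Fintype.card_prod, hD, hρ]
    rw [h1, h2, h3]
    omega
  · obtain ⟨lead, slot, role, hlay, hrun⟩ := h.exists_run_backboneProtocol henc F hm1
    rw [BackboneBuilder.records, hrun]
    exact hlay.simulatesMessagePassing henc
  · have h1 : (convergecast P N Δ c R enc).rounds =
        0 + Fintype.card (P.BoxClass × Fin (Δ + 1)) := rfl
    rw [h1, Fintype.card_prod, Fintype.card_fin, ← hD, zero_add]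
    calc D * (Δ + 1) ≤ D * (2 * Δ) := Nat.mul_le_mul_left _ (by omega)
      _ = 2 * D * Δ := by ring
      _ ≤ c * Δ := Nat.mul_le_mul_right _ (by omega)
  · obtain ⟨lead, slot, role, hlay, hrun⟩ := h.exists_run_backboneProtocol henc F hm1
    rw [BackboneBuilder.records, hrun]
    exact hlay.collectsAtLeaders henc
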